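/- For complex $\nu$ and $w$ let $J_\nu(w)=(w/2)^\nu\sum_{k\ge0}\frac{(-1)^k(w/2)^{2k}}{k!\,\Gamma(\nu+k+1)}$ and $I_\nu(w)=(w/2)^\nu\sum_{k\ge0}\frac{(w/2)^{2k}}{k!\,\Gamma(\nu+k+1)}$ be the Bessel and modified Bessel functions of the first kind, let $K_\mu(w)=\int_0^\infty e^{-w\cosh u}\cosh(\mu u)\,du$ $(\operatorname{Re}w>0)$ be the modified Bessel function of the second kind, and let ${}_0F_3(p,q,r;w)=\sum_{n\ge0}\frac{w^n}{n!\,(p)_n(q)_n(r)_n}$, where $(p)_n=p(p+1)\cdots(p+n-1)$. All complex powers are principal values (with $0^0=1$ and $0^\alpha=0$ for $\alpha\ne0$, which matters only when $x=0$). Let $\mu,\nu,a,b,x\in\mathbb C$ with $a\neq0$, $b\ne0$, $\mu\notin\{-1,-2,-3,\dots\}$, and $$\operatorname{Re}\nu>-1,\qquad \operatorname{Re}(\mu+\nu)>-1,\qquad \left|\operatorname{Re}\frac ba\right|<1,$$ and put $z=\tfrac12ax\left(1-\frac{b^2}{a^2}\right)$. Then the function $t\mapsto t^{\mu+\nu+1}\,{}_0F_3(\mu+1,\nu+1,\mu+\nu+1;-z^2t^2)\,K_\mu(2t)\,I_\nu\!\left(2\tfrac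 bat\right)$ is (absolutely) integrable on $(0,\infty)$, and $$\Gamma(\mu+1)\Gamma(\nu+1)\Gamma(\mu+\nu+1)\,J_\mu(ax)J_\nu(bx)=4\left(\tfrac12ax\right)^{\mu}\left(\tfrac12bx\right)^{\nu}\left(1-\tfrac{b^2}{a^2}\right)^{\mu+\nu+1}\left(\tfrac ba\right)^{-\nu}\int_0^\infty t^{\mu+\nu+1}\,{}_0F_3(\mu+1,\nu+1,\mu+\nu+1;-z^2t^2)\,K_\mu(2t)\,I_\nu\!\left(2\tfrac bat\right)dt .$$ (The factor $(b/a)^{-\nu}$ equals $(a/b)^{\nu}$ unless $b/a$ is a negative real number.) -/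

import Mathlib

noncomputable section

/-- The Bessel function of the first kind
`J_ν(w) = ∑_k (-1)^k (w/2)^(ν+2k) / (k! Γ(ν+k+1))`, with the principal branch of `(w/2)^ν`.
(`Complex.Gamma` is `0` at its poles, so its inverse is the entire function `1/Γ`.) -/
def besselJ (ν w : ℂ) : ℂ :=
  (w / 2) ^ ν *
    ∑' k : ℕ, (-1 : ℂ) ^ k * (w / 2) ^ (2 * k) *
      ((Nat.factorial k : ℂ) * Complex.Gamma (ν + (k : ℂ) + 1))⁻¹

/-- The modified Bessel function of the first kind
`I_ν(w) = ∑_k (w/2)^(ν+2k) / (k! Γ(ν+k+1))`, with the principal branch of `(w/2)^ν`. -/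
def besselI (ν w : ℂ) : ℂ :=
  (w / 2) ^ ν *
    ∑' k : ℕ, (w / 2) ^ (2 * k) *
      ((Nat.factorial k : ℂ) * Complex.Gamma (ν + (k : ℂ) + 1))⁻¹

/-- The modified Bessel function of the second kind (Macdonald function)
`K_μ(w) = ∫_0^∞ exp(-w cosh u) cosh(μ u) du`, for `Re w > 0` and every complex order `μ`. -/
def besselK (μ w : ℂ) : ℂ :=
  ∫ u in Set.Ioi (0 : ℝ), Complex.exp (-w * Complex.cosh (u : ℂ)) * Complex.cosh (μ * (u : ℂ))

/-- The generalized hypergeometric function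
`₀F₃(p, q, r; w) = ∑_n w^n / (n! (p)_n (q)_n (r)_n)`, where `(p)_n = p (p+1) ⋯ (p+n-1)`;
`p`, `q`, `r` are meant not to be non-positive integers. -/
def hypergeometric0F3 (p q r w : ℂ) : ℂ :=
  ∑' n : ℕ, w ^ n / ((Nat.factorial n : ℂ) * (ascPochhammer ℂ n).eval p *
    (ascPochhammer ℂ n).eval q * (ascPochhammer ℂ n).eval r)

end

/-!
Put `c = b / a`, `q = 1 - c²` and `E_ν(w) = ∑_k w^(2k) / (k! Γ(ν+k+1))`, so that
`I_ν(2w) = w^ν E_ν(w)` and `J_ν(w) = (w/2)^ν E_ν(iw/2)`. Since `|Re c| < 1` gives `Re q > 0`, the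
number `q` stays off the branch cut of the principal power `q^(μ+ν+1)`.

*Convergence.* The substitution `s = t e^u` turns the definition of `K_μ` into
`K_μ(2t) = ½ t^(-μ) ∫₀^∞ s^(μ-1) exp(-s - t²/s) ds` (`besselK_two_mul`), which makes the integral a
double integral over `s, t > 0`. Poisson's integral, together with a recurrence to reach
`Re ν > -1`, shows that `E_ν(ct)` is at most a polynomial times `exp(2 |Re c| t)`
(`exists_norm_besselE_le`). The function `₀F₃(…; -z²t²)` is `O(exp(εt))` for every `ε > 0`, because
its coefficients decay like `(n!)⁻⁴` (`exists_norm_hypergeometric0F3_term_le`). The product of the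
two is thus `O(exp(2γt))` for some `γ < 1`, and `2t ≤ s + t²/s` gives absolute convergence of the double
integral (`integrable_prod_mul_cpow`).

*Evaluation.* Fubini's theorem and termwise integration of `₀F₃` leave the moments of
`K_μ(2t) I_ν(2ct)`. For fixed `s`, the integral over `t` is a series `₁F₁(ν+1+n; ν+1; c²s)`, which
Kummer's transformation turns into `exp(c²s)` times a polynomial of degree `n`
(`setIntegral_besselE_mul_exp_neg_sq_div`). The integral over `s` is then a finite sum of Gamma
integrals with rate `q` (`setIntegral_pow_mul_besselE_mul_besselK`). In this order of integration no
hypergeometric series in `c²` appears that would converge only for `|c| < 1`.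

*Comparison.* The `n`-th coefficient of `E_μ(w) E_ν(cw)` is a multiple of the polynomial
`₂F₁(-n, -μ-n; ν+1; c²)` (`hasSum_besselE_mul_besselE`), and `q^(μ+ν+1) q^(2n)` times the
`n`-th moment (the factor `q^(2n)` comes from `z^(2n)`) is a multiple of
`q^n ₂F₁(-n, μ+ν+1+n; ν+1; -c²/q)`. The two polynomials are equal by the terminating case of Pfaff's
transformation (`terminating_pfaff`), which comes down to the Chu–Vandermonde identity.
-/

open MeasureTheory

/-! ### Rising factorials and terminating hypergeometric sums -/

/-- The rising factorial `(a)_n = a (a+1) ⋯ (a+n-1)`. -/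
noncomputable def rising (a : ℂ) (n : ℕ) : ℂ := (ascPochhammer ℂ n).eval a

@[simp] theorem rising_zero (a : ℂ) : rising a 0 = 1 := by simp [rising]

theorem rising_succ (a : ℂ) (n : ℕ) : rising a (n + 1) = rising a n * (a + n) := by
  simp [rising, ascPochhammer_succ_eval]

theorem rising_add (a : ℂ) (m n : ℕ) : rising a (m + n) = rising a m * rising (a + m) n := by
  simp [rising, ← ascPochhammer_mul]

theorem rising_succ_left (a : ℂ) (n : ℕ) : rising a (n + 1) = a * rising (a + 1) n := by
  rw [add_comm, rising_add, rising_succ]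
  simp

theorem rising_ne_zero {a : ℂ} (ha : ∀ k : ℕ, a ≠ -k) (n : ℕ) : rising a n ≠ 0 := by
  induction n with
  | zero => simp
  | succ n ih =>
    rw [rising_succ]
    exact mul_ne_zero ih fun h => ha n (eq_neg_of_add_eq_zero_left h)

theorem Gamma_add_nat_eq_rising {a : ℂ} (ha : ∀ k : ℕ, a ≠ -k) (n : ℕ) :
    Complex.Gamma (a + n) = Complex.Gamma a * rising a n := by
  rw [rising, ← Complex.Gamma_add_nat_div_Gamma_eq a ha,
    mul_div_cancel₀ _ (Complex.Gamma_ne_zero ha)]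

theorem rising_neg_reflect (a : ℂ) (n : ℕ) : (-1) ^ n * rising (1 - a - n) n = rising a n := by
  induction n generalizing a with
  | zero => simp
  | succ n ih =>
    rw [rising_succ_left, rising_succ, ← ih a]
    push_cast
    rw [show 1 - a - (n + 1 : ℂ) + 1 = 1 - a - n by ring]
    ring

/-- Pascal's rule for sums weighted by binomial coefficients. -/
theorem sum_choose_succ (m : ℕ) (f : ℕ → ℂ) :
    ∑ j ∈ Finset.range (m + 2), ((m + 1).choose j : ℂ) * f j =
      ∑ j ∈ Finset.range (m + 1), (m.choose j : ℂ) * (f j + f (j + 1)) := by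
  have h1 : ∑ j ∈ Finset.range (m + 1), (m.choose j : ℂ) * f j =
      f 0 + ∑ j ∈ Finset.range (m + 1), (m.choose (j + 1) : ℂ) * f (j + 1) := by
    have := Finset.sum_range_succ (fun j => (m.choose j : ℂ) * f j) (m + 1)
    rw [Finset.sum_range_succ'] at this
    simp at this
    rw [← this]
    ring
  rw [Finset.sum_range_succ']
  simp only [Nat.choose_succ_succ', Nat.cast_add, mul_add, add_mul, Finset.sum_add_distrib, h1]
  simp
  ring

/-- The Chu–Vandermonde identity. -/
theorem sum_choose_mul_rising (m : ℕ) (B C : ℂ) :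
    ∑ j ∈ Finset.range (m + 1),
        (m.choose j : ℂ) * ((-1) ^ j * rising B j * rising (C + j) (m - j)) =
      rising (C - B) m := by
  induction m generalizing C with
  | zero => simp
  | succ m ih =>
    rw [sum_choose_succ, rising_succ_left, show C - B + 1 = C + 1 - B by ring, ← ih,
      Finset.mul_sum]
    refine Finset.sum_congr rfl fun j hj => ?_
    have hj : j ≤ m := Nat.lt_succ_iff.mp (Finset.mem_range.mp hj)
    rw [Nat.succ_sub hj, Nat.succ_eq_add_one, rising_succ_left, Nat.add_sub_add_right, rising_succ]
    push_cast
    rw [show C + (j + 1 : ℂ) = C + 1 + j by ring, show C + (j : ℂ) + 1 = C + 1 + j by ring]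
    ring

/-- The terminating case of Pfaff's transformation
`(1 - y)^n ₂F₁(-n, B; C; y / (y - 1)) = ₂F₁(-n, C - B; C; y)`, multiplied by `(C)_n`. -/
theorem terminating_pfaff (n : ℕ) (B C y : ℂ) :
    ∑ j ∈ Finset.range (n + 1),
        (n.choose j : ℂ) * rising (C + j) (n - j) * rising B j * y ^ j * (1 - y) ^ (n - j) =
      ∑ l ∈ Finset.range (n + 1),
        (n.choose l : ℂ) * rising (C + l) (n - l) * ((-1) ^ l * rising (C - B) l) * y ^ l := by
  -- Expand `(1 - y)^(n - j)` and collect the coefficient of `y^l`.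
  have expand : ∀ j ∈ Finset.range (n + 1),
      (n.choose j : ℂ) * rising (C + j) (n - j) * rising B j * y ^ j * (1 - y) ^ (n - j) =
      ∑ l ∈ Finset.Ico j (n + 1), (n.choose l : ℂ) * rising (C + l) (n - l) * y ^ l * (-1) ^ l *
        ((l.choose j : ℂ) * ((-1) ^ j * rising B j * rising (C + j) (l - j))) := by
    intro j hj
    have hj : j ≤ n := Nat.lt_succ_iff.mp (Finset.mem_range.mp hj)
    rw [Finset.sum_Ico_eq_sum_range, sub_eq_neg_add, add_pow, Finset.mul_sum,
      show n + 1 - j = n - j + 1 by omega]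
    refine Finset.sum_congr rfl fun i hi => ?_
    have hi : i ≤ n - j := Nat.lt_succ_iff.mp (Finset.mem_range.mp hi)
    have hc : (n.choose (j + i) : ℂ) * ((j + i).choose j : ℂ) =
        (n.choose j : ℂ) * ((n - j).choose i : ℂ) := by
      have := Nat.choose_mul (n := n) (k := j + i) (s := j) (by omega)
      rw [Nat.add_sub_cancel_left] at this
      exact_mod_cast this
    have hr : rising (C + j) (n - j) =
        rising (C + j) i * rising (C + (j + i : ℕ)) (n - (j + i)) := by
      rw [show n - j = i + (n - (j + i)) by omega, rising_add]
      push_cast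
      ring_nf
    have hs : ((-1 : ℂ) ^ j) * (-1) ^ j = 1 := by rw [← mul_pow]; simp
    rw [hr, Nat.add_sub_cancel_left, one_pow, mul_one, neg_pow y, pow_add, pow_add]
    linear_combination (rising (C + j) i * rising (C + (j + i : ℕ)) (n - (j + i)) * rising B j *
      y ^ j * y ^ i * (-1) ^ i) * (-hc - (n.choose (j + i) : ℂ) * ((j + i).choose j : ℂ) * (hs))
  rw [Finset.sum_congr rfl expand, Finset.sum_comm' (t' := Finset.range (n + 1))
    (s' := fun l => Finset.range (l + 1)) (by simp; omega)]
  refine Finset.sum_congr rfl fun l _ => ?_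
  rw [← Finset.mul_sum, sum_choose_mul_rising]
  ring

/-! ### Growth of the Bessel and hypergeometric series -/

theorem ne_neg_nat_of_re_pos {a : ℂ} (ha : 0 < a.re) (k : ℕ) : a ≠ -k := by
  rintro rfl
  have : (0 : ℝ) ≤ k := k.cast_nonneg
  simp at ha
  linarith

/-- A lower bound for `a + k` that is uniform in `k`; over `k < n` it multiplies up to
`|(a)_n| ≥ m^n n!`. -/
theorem exists_pos_mul_le_norm_add_nat {a : ℂ} (ha : ∀ k : ℕ, a ≠ -k) :
    ∃ m : ℝ, 0 < m ∧ ∀ k : ℕ, m * (k + 1) ≤ ‖a + k‖ := by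
  have hpos (k : ℕ) : 0 < ‖a + k‖ := norm_pos_iff.mpr fun h => ha k (eq_neg_of_add_eq_zero_left h)
  -- Finitely many `k` are handled by a minimum, the others by `‖a + k‖ ≥ k - ‖a‖ ≥ (k + 1) / 2`.
  obtain ⟨N, hN⟩ := exists_nat_ge (2 * ‖a‖ + 1)
  have hfin (N : ℕ) : ∃ m : ℝ, 0 < m ∧ ∀ k < N, m * (k + 1) ≤ ‖a + k‖ := by
    induction N with
    | zero => exact ⟨1, one_pos, by simp⟩
    | succ N ih =>
      obtain ⟨m, hm, h⟩ := ih
      refine ⟨min m (‖a + N‖ / (N + 1)), lt_min hm (div_pos (hpos N) (by positivity)),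
        fun k hk => ?_⟩
      rcases Nat.lt_succ_iff_lt_or_eq.mp hk with hk | rfl
      · exact (mul_le_mul_of_nonneg_right (min_le_left _ _) (by positivity)).trans (h k hk)
      · exact (mul_le_mul_of_nonneg_right (min_le_right _ _) (by positivity)).trans_eq
          (div_mul_cancel₀ _ (by positivity))
  obtain ⟨m, hm, h⟩ := hfin N
  refine ⟨min m (1 / 2), lt_min hm (by norm_num), fun k => ?_⟩
  rcases lt_or_ge k N with hk | hk
  · exact (mul_le_mul_of_nonneg_right (min_le_left _ _) (by positivity)).trans (h k hk)
  · refine (mul_le_mul_of_nonneg_right (min_le_right _ _) (by positivity)).trans ?_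
    have h1 : (k : ℝ) ≤ ‖a + k‖ + ‖a‖ := by
      simpa using norm_sub_le (a + k) a
    have h2 : (N : ℝ) ≤ k := by exact_mod_cast hk
    linarith

theorem exists_pow_mul_factorial_le_norm_rising {a : ℂ} (ha : ∀ k : ℕ, a ≠ -k) :
    ∃ m : ℝ, 0 < m ∧ ∀ n : ℕ, m ^ n * n.factorial ≤ ‖rising a n‖ := by
  obtain ⟨m, hm, h⟩ := exists_pos_mul_le_norm_add_nat ha
  refine ⟨m, hm, fun n => ?_⟩
  induction n with
  | zero => simp
  | succ n ih =>
    rw [rising_succ, norm_mul, pow_succ, Nat.factorial_succ]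
    calc m ^ n * m * ((n + 1) * n.factorial : ℕ) = m ^ n * n.factorial * (m * (n + 1)) := by
          push_cast; ring
      _ ≤ _ := mul_le_mul ih (h n) (by positivity) (norm_nonneg _)

theorem inv_factorial_sq_le (n : ℕ) :
    ((n.factorial : ℝ) ^ 2)⁻¹ ≤ 2 ^ (2 * n) / (2 * n).factorial := by
  rw [inv_eq_one_div, div_le_div_iff₀ (by positivity) (by positivity), one_mul]
  have h := Nat.choose_mul_factorial_mul_factorial (n := 2 * n) (k := n) (by omega)
  rw [show 2 * n - n = n by omega] at h
  rw [← h]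
  push_cast
  rw [mul_assoc, ← sq]
  gcongr
  exact_mod_cast Nat.choose_le_two_pow (2 * n) n

/-- The even entire function `E_ν(w) = ∑_k w^(2k) / (k! Γ(ν+k+1))`, for which
`I_ν(2w) = w^ν E_ν(w)`. -/
noncomputable def besselE (ν w : ℂ) : ℂ :=
  ∑' k : ℕ, w ^ (2 * k) * ((Nat.factorial k : ℂ) * Complex.Gamma (ν + (k : ℂ) + 1))⁻¹

theorem exists_norm_inv_factorial_mul_Gamma_le {ν : ℂ} (hν : ∀ k : ℕ, ν + 1 ≠ -k) :
    ∃ C B : ℝ, 0 ≤ C ∧ 0 ≤ B ∧ ∀ k : ℕ,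
      ‖((Nat.factorial k : ℂ) * Complex.Gamma (ν + (k : ℂ) + 1))⁻¹‖ ≤
        C * (B ^ (2 * k) / (2 * k).factorial) := by
  obtain ⟨m, hm, h⟩ := exists_pow_mul_factorial_le_norm_rising hν
  refine ⟨‖(Complex.Gamma (ν + 1))⁻¹‖, 2 * √(m⁻¹), norm_nonneg _, by positivity, fun k => ?_⟩
  rw [show ν + (k : ℂ) + 1 = ν + 1 + k by ring, Gamma_add_nat_eq_rising hν, mul_left_comm,
    mul_inv, norm_mul, mul_pow, pow_mul √_, Real.sq_sqrt (by positivity), norm_inv (_ * _),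
    norm_mul,
    Complex.norm_natCast]
  gcongr
  calc ((k.factorial : ℝ) * ‖rising (ν + 1) k‖)⁻¹
      ≤ ((k.factorial : ℝ) * (m ^ k * k.factorial))⁻¹ := by gcongr; exact h k
    _ = ((k.factorial : ℝ) ^ 2)⁻¹ * m⁻¹ ^ k := by
      rw [inv_pow, ← mul_inv]; ring_nf
    _ ≤ (2 ^ (2 * k) / (2 * k).factorial) * m⁻¹ ^ k := by
      gcongr; exact inv_factorial_sq_le k
    _ = _ := by ring

theorem summable_pow_two_mul_div_factorial (x : ℝ) :
    Summable fun k : ℕ => x ^ (2 * k) / ((2 * k).factorial : ℝ) := (Real.hasSum_cosh x).summable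

theorem tsum_pow_two_mul_div_factorial_le (x : ℝ) :
    ∑' k : ℕ, x ^ (2 * k) / ((2 * k).factorial : ℝ) ≤ Real.exp |x| := by
  rw [← Real.cosh_eq_tsum, ← Real.cosh_abs, Real.cosh_eq]
  have := Real.exp_le_exp.mpr (show -|x| ≤ |x| by linarith [abs_nonneg x])
  linarith

theorem exists_norm_besselE_term_le {ν : ℂ} (hν : ∀ k : ℕ, ν + 1 ≠ -k) :
    ∃ C B : ℝ, 0 ≤ C ∧ 0 ≤ B ∧ ∀ (k : ℕ) (w : ℂ),
      ‖w ^ (2 * k) * ((Nat.factorial k : ℂ) * Complex.Gamma (ν + (k : ℂ) + 1))⁻¹‖ ≤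
        C * ((B * ‖w‖) ^ (2 * k) / (2 * k).factorial) := by
  obtain ⟨C, B, hC, hB, h⟩ := exists_norm_inv_factorial_mul_Gamma_le hν
  refine ⟨C, B, hC, hB, fun k w => ?_⟩
  rw [norm_mul, norm_pow]
  calc _ ≤ ‖w‖ ^ (2 * k) * (C * (B ^ (2 * k) / (2 * k).factorial)) := by gcongr; exact h k
    _ = _ := by ring

theorem summable_norm_besselE {ν : ℂ} (hν : ∀ k : ℕ, ν + 1 ≠ -k) (w : ℂ) :
    Summable fun k : ℕ =>
      ‖w ^ (2 * k) * ((Nat.factorial k : ℂ) * Complex.Gamma (ν + (k : ℂ) + 1))⁻¹‖ := by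
  obtain ⟨C, B, hC, hB, h⟩ := exists_norm_besselE_term_le hν
  exact Summable.of_nonneg_of_le (fun _ => norm_nonneg _) (fun k => h k w)
    ((summable_pow_two_mul_div_factorial _).mul_left C)

theorem hasSum_besselE {ν : ℂ} (hν : ∀ k : ℕ, ν + 1 ≠ -k) (w : ℂ) :
    HasSum (fun k : ℕ =>
      w ^ (2 * k) * ((Nat.factorial k : ℂ) * Complex.Gamma (ν + (k : ℂ) + 1))⁻¹) (besselE ν w) :=
  (summable_norm_besselE hν w).of_norm.hasSum

theorem measurable_besselE {ν : ℂ} (hν : ∀ k : ℕ, ν + 1 ≠ -k) : Measurable (besselE ν) :=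
  measurable_of_tendsto_metrizable (f := fun N : ℕ => fun w : ℂ => ∑ k ∈ Finset.range N,
      w ^ (2 * k) * ((Nat.factorial k : ℂ) * Complex.Gamma (ν + (k : ℂ) + 1))⁻¹)
    (fun N => by fun_prop) (tendsto_pi_nhds.mpr fun w => (hasSum_besselE hν w).tendsto_sum_nat)

theorem norm_cosh_le (u : ℂ) : ‖Complex.cosh u‖ ≤ Real.exp |u.re| := by
  rw [Complex.cosh, norm_div, Complex.norm_ofNat]
  have h := norm_add_le (Complex.exp u) (Complex.exp (-u))
  rw [Complex.norm_exp, Complex.norm_exp, Complex.neg_re] at h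
  have h1 := Real.exp_le_exp.mpr (le_abs_self u.re)
  have h2 := Real.exp_le_exp.mpr (neg_le_abs u.re)
  linarith

/-- Poisson's integral
`√π Γ(ν+1/2) E_ν(w) = ∫₀¹ cosh(2w√v) v^(-1/2) (1-v)^(ν-1/2) dv` bounds `E_ν`. -/
theorem exists_norm_besselE_le_of_neg_half_lt {ν : ℂ} (hν : -(1 / 2) < ν.re) :
    ∃ C : ℝ, 0 ≤ C ∧ ∀ w : ℂ, ‖besselE ν w‖ ≤ C * Real.exp (2 * |w.re|) := by
  have hν1 : ∀ k : ℕ, ν + 1 ≠ -k := ne_neg_nat_of_re_pos (by simp; linarith)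
  have hν2 : 0 < (ν + 1 / 2).re := by simp at hν ⊢; linarith
  set g : ℝ → ℂ := fun v => (v : ℂ) ^ ((1 / 2 : ℂ) - 1) * (1 - (v : ℂ)) ^ (ν + 1 / 2 - 1) with hg
  have hgi : IntervalIntegrable g MeasureTheory.volume 0 1 :=
    Complex.betaIntegral_convergent (by norm_num) hν2
  -- The coefficients are Beta integrals, by the duplication formula for `Γ (k + 1/2) k!`.
  have hcoef (k : ℕ) : ((Nat.factorial k : ℂ) * Complex.Gamma (ν + (k : ℂ) + 1))⁻¹ =
      ((√Real.pi : ℂ) * Complex.Gamma (ν + 1 / 2))⁻¹ * (2 ^ (2 * k) / (2 * k).factorial) *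
        Complex.betaIntegral (k + 1 / 2) (ν + 1 / 2) := by
    have hk : 0 < ((k : ℂ) + 1 / 2).re := by simp; positivity
    have h1 := Complex.Gamma_mul_Gamma_eq_betaIntegral hk hν2
    have h2 := Complex.Gamma_mul_Gamma_add_half (k + 1 / 2)
    rw [show (k : ℂ) + 1 / 2 + 1 / 2 = k + 1 by ring, Complex.Gamma_nat_eq_factorial,
      show 2 * ((k : ℂ) + 1 / 2) = ((2 * k : ℕ) : ℂ) + 1 by push_cast; ring,
      Complex.Gamma_nat_eq_factorial,
      show (1 : ℂ) - (((2 * k : ℕ) : ℂ) + 1) = -((2 * k : ℕ) : ℂ) by ring,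
      Complex.cpow_neg, Complex.cpow_natCast] at h2
    rw [show (k : ℂ) + 1 / 2 + (ν + 1 / 2) = ν + k + 1 by ring] at h1
    have n1 : Complex.Gamma (ν + 1 / 2) ≠ 0 := Complex.Gamma_ne_zero_of_re_pos hν2
    have n2 : Complex.Gamma (k + 1 / 2) ≠ 0 := Complex.Gamma_ne_zero_of_re_pos hk
    have n3 : Complex.Gamma (ν + k + 1) ≠ 0 := by
      refine Complex.Gamma_ne_zero_of_re_pos ?_
      simp; have : (0 : ℝ) ≤ k := k.cast_nonneg
      linarith
    have n4 : (√Real.pi : ℂ) ≠ 0 := by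
      exact_mod_cast (Real.sqrt_pos.mpr Real.pi_pos).ne'
    have n5 : (k.factorial : ℂ) ≠ 0 := by exact_mod_cast k.factorial_ne_zero
    have n6 : ((2 * k).factorial : ℂ) ≠ 0 := by exact_mod_cast (2 * k).factorial_ne_zero
    have hb : Complex.betaIntegral (k + 1 / 2) (ν + 1 / 2) =
        Complex.Gamma (k + 1 / 2) * Complex.Gamma (ν + 1 / 2) / Complex.Gamma (ν + k + 1) := by
      rw [h1, mul_div_cancel_left₀ _ n3]
    have hG : Complex.Gamma (k + 1 / 2) =
        ((2 * k).factorial * (2 ^ (2 * k))⁻¹ * √Real.pi) / k.factorial := by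
      rw [← h2, mul_div_cancel_right₀ _ n5]
    rw [hb, hG]
    generalize Complex.Gamma (ν + 1 / 2) = G at n1 ⊢
    field_simp
  refine ⟨‖((√Real.pi : ℂ) * Complex.Gamma (ν + 1 / 2))⁻¹‖ * ∫ v in (0 : ℝ)..1, ‖g v‖,
    mul_nonneg (norm_nonneg _)
      (intervalIntegral.integral_nonneg zero_le_one fun _ _ => norm_nonneg _),
    fun w => ?_⟩
  set f : ℝ → ℂ := fun v => Complex.cosh (2 * w * √v) * g v with hf
  have key : HasSum (fun k : ℕ => ∫ v in (0 : ℝ)..1,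
      (2 * w) ^ (2 * k) / (2 * k).factorial * ((v : ℂ) ^ ((k + 1 / 2 : ℂ) - 1) *
        (1 - (v : ℂ)) ^ (ν + 1 / 2 - 1))) (∫ v in (0 : ℝ)..1, f v) := by
    have hterm (k : ℕ) {v : ℝ} (hv : v ∈ Set.uIoc (0 : ℝ) 1) :
        (2 * w) ^ (2 * k) / (2 * k).factorial * ((v : ℂ) ^ ((k + 1 / 2 : ℂ) - 1) *
          (1 - (v : ℂ)) ^ (ν + 1 / 2 - 1)) =
        (2 * w * √v) ^ (2 * k) / (2 * k).factorial * g v := by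
      rw [Set.uIoc_of_le zero_le_one] at hv
      have hv0 : (v : ℂ) ≠ 0 := by exact_mod_cast hv.1.ne'
      have : ((√v : ℝ) : ℂ) ^ (2 * k) = (v : ℂ) ^ k := by
        rw [pow_mul, ← Complex.ofReal_pow, Real.sq_sqrt hv.1.le]
      rw [add_sub_assoc, Complex.cpow_add _ _ hv0, Complex.cpow_natCast, mul_pow _ (√v : ℂ), this,
        hg]
      ring
    refine intervalIntegral.hasSum_integral_of_dominated_convergence
      (fun k v => ‖2 * w‖ ^ (2 * k) / (2 * k).factorial * ‖g v‖) (fun k => ?_) (fun k => ?_)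
      ?_ ?_ ?_
    · have hk : 0 < ((k : ℂ) + 1 / 2).re := by simp; positivity
      exact (intervalIntegrable_iff.mp
        ((Complex.betaIntegral_convergent hk hν2).const_mul _)).aestronglyMeasurable
    · refine Filter.Eventually.of_forall fun v hv => ?_
      rw [hterm k hv, norm_mul, norm_div, norm_pow, norm_mul (2 * w), Complex.norm_natCast]
      rw [Set.uIoc_of_le zero_le_one] at hv
      gcongr
      refine mul_le_of_le_one_right (norm_nonneg _) ?_
      rw [Complex.norm_real, Real.norm_of_nonneg (Real.sqrt_nonneg _)]
      exact Real.sqrt_le_one.mpr hv.2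
    · exact Filter.Eventually.of_forall fun v _ =>
        (summable_pow_two_mul_div_factorial _).mul_right _
    · simp_rw [tsum_mul_right]
      exact hgi.norm.const_mul _
    · refine Filter.Eventually.of_forall fun v hv => ?_
      simp_rw [hterm _ hv]
      exact (Complex.hasSum_cosh _).mul_right _
  have hE : besselE ν w =
      ((√Real.pi : ℂ) * Complex.Gamma (ν + 1 / 2))⁻¹ * ∫ v in (0 : ℝ)..1, f v := by
    refine (hasSum_besselE hν1 w).unique ?_
    convert! key.mul_left _ using 2 with k
    rw [intervalIntegral.integral_const_mul, hcoef k, Complex.betaIntegral]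
    ring
  rw [hE, norm_mul, mul_assoc]
  gcongr
  rw [← intervalIntegral.integral_mul_const]
  refine intervalIntegral.norm_integral_le_of_norm_le zero_le_one ?_ (hgi.norm.mul_const _)
  refine Filter.Eventually.of_forall fun v hv => ?_
  rw [hf, norm_mul, mul_comm]
  gcongr
  refine (norm_cosh_le _).trans (Real.exp_le_exp.mpr ?_)
  have : (2 * w * (√v : ℝ)).re = 2 * w.re * √v := by simp
  rw [this, abs_mul, abs_mul, abs_two, abs_of_nonneg (Real.sqrt_nonneg v)]
  exact mul_le_of_le_one_right (by positivity) (Real.sqrt_le_one.mpr hv.2)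

/-- The three-term recurrence for `I_ν`. It carries the growth bound from `Re ν > 0` to `Re ν > -1`,
where Poisson's integral may diverge. -/
theorem besselE_eq_add {ν : ℂ} (hν : -1 < ν.re) (w : ℂ) :
    besselE ν w = (ν + 1) * besselE (ν + 1) w + w ^ 2 * besselE (ν + 2) w := by
  have h0 : ∀ k : ℕ, ν + 1 ≠ -k := ne_neg_nat_of_re_pos (by simp; linarith)
  have h1 : ∀ k : ℕ, ν + 1 + 1 ≠ -k := ne_neg_nat_of_re_pos (by simp; linarith)
  have h2 : ∀ k : ℕ, ν + 2 + 1 ≠ -k := ne_neg_nat_of_re_pos (by simp; linarith)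
  have hs1 := hasSum_besselE h1 w
  have hs2 := (hasSum_besselE h2 w).mul_left (w ^ 2)
  -- Write `1 / Γ(ν+k+1) = (ν+1) / Γ(ν+k+2) + k / Γ(ν+k+2)`; the second part is the shifted series.
  have hs2' : HasSum (fun k : ℕ => w ^ (2 * k) * ((k : ℂ) *
      ((Nat.factorial k : ℂ) * Complex.Gamma (ν + 1 + (k : ℂ) + 1))⁻¹))
      (w ^ 2 * besselE (ν + 2) w) := by
    rw [← hasSum_nat_add_iff' 1]
    simp only [Finset.range_one, Finset.sum_singleton, Nat.cast_zero, zero_mul, mul_zero, sub_zero]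
    convert! hs2 using 2 with k
    have hk : ((k : ℂ) + 1) ≠ 0 := Nat.cast_add_one_ne_zero k
    rw [Nat.factorial_succ, show ν + 1 + ((k + 1 : ℕ) : ℂ) + 1 = ν + 2 + k + 1 by push_cast; ring]
    push_cast
    rw [mul_assoc, mul_inv ((k : ℂ) + 1), mul_inv_cancel_left₀ hk]
    ring
  refine (hasSum_besselE h0 w).unique ?_
  convert! (hs1.mul_left (ν + 1)).add hs2' using 2 with k
  have hk : ν + k + 1 ≠ 0 := fun h => h0 k (by linear_combination h)
  have hG : Complex.Gamma (ν + 1 + k + 1) = (ν + k + 1) * Complex.Gamma (ν + k + 1) := by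
    rw [← Complex.Gamma_add_one _ hk]
    ring_nf
  rw [hG, mul_left_comm (k.factorial : ℂ), mul_inv (ν + k + 1)]
  linear_combination (-w ^ (2 * k) * ((Nat.factorial k : ℂ) * Complex.Gamma (ν + k + 1))⁻¹) *
    mul_inv_cancel₀ hk

theorem exists_norm_besselE_le {ν : ℂ} (hν : -1 < ν.re) :
    ∃ C : ℝ, 0 ≤ C ∧ ∀ w : ℂ, ‖besselE ν w‖ ≤ C * ((1 + ‖w‖ ^ 2) * Real.exp (2 * |w.re|)) := by
  obtain ⟨C₁, hC₁, h₁⟩ := exists_norm_besselE_le_of_neg_half_lt (ν := ν + 1) (by simp; linarith)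
  obtain ⟨C₂, hC₂, h₂⟩ := exists_norm_besselE_le_of_neg_half_lt (ν := ν + 2) (by simp; linarith)
  refine ⟨‖ν + 1‖ * C₁ + C₂, by positivity, fun w => ?_⟩
  rw [besselE_eq_add hν]
  refine (norm_add_le _ _).trans ?_
  rw [norm_mul, norm_mul, norm_pow]
  have e := Real.exp_pos (2 * |w.re|)
  calc _ ≤ ‖ν + 1‖ * (C₁ * Real.exp (2 * |w.re|)) + ‖w‖ ^ 2 * (C₂ * Real.exp (2 * |w.re|)) := by
        gcongr
        · exact h₁ w
        · exact h₂ w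
    _ ≤ _ := by
      have := mul_nonneg (mul_nonneg (mul_nonneg (norm_nonneg (ν + 1)) hC₁) (sq_nonneg ‖w‖)) e.le
      have := mul_nonneg hC₂ e.le
      nlinarith

theorem exists_norm_hypergeometric0F3_term_le {p q r : ℂ} (hp : ∀ k : ℕ, p ≠ -k)
    (hq : ∀ k : ℕ, q ≠ -k) (hr : ∀ k : ℕ, r ≠ -k) (z : ℂ) {ε : ℝ} (hε : 0 < ε) :
    ∃ C : ℝ, 0 ≤ C ∧ ∀ (n : ℕ) (t : ℝ),
      ‖(-z ^ 2 * (t : ℂ) ^ 2) ^ n /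
          ((Nat.factorial n : ℂ) * rising p n * rising q n * rising r n)‖ ≤
        C * ((ε * t) ^ (2 * n) / (2 * n).factorial) := by
  obtain ⟨m₁, hm₁, h₁⟩ := exists_pow_mul_factorial_le_norm_rising hp
  obtain ⟨m₂, hm₂, h₂⟩ := exists_pow_mul_factorial_le_norm_rising hq
  obtain ⟨m₃, hm₃, h₃⟩ := exists_pow_mul_factorial_le_norm_rising hr
  -- Only two of the four factorials in the denominator are needed for `(2n)!`; a third one
  -- absorbs the geometric factors.
  set X : ℝ := 4 * (‖z‖ ^ 2 / (m₁ * m₂ * m₃)) / ε ^ 2 with hX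
  refine ⟨Real.exp X, (Real.exp_pos X).le, fun n t => ?_⟩
  have hfac : (1 : ℝ) ≤ n.factorial := by exact_mod_cast n.factorial_pos
  have hn : (0 : ℝ) < n.factorial := by positivity
  rw [norm_div, norm_mul, norm_mul, norm_mul, Complex.norm_natCast, norm_pow, norm_mul, norm_neg,
    norm_pow, norm_pow, Complex.norm_real, Real.norm_eq_abs, sq_abs]
  calc (‖z‖ ^ 2 * t ^ 2) ^ n / (n.factorial * ‖rising p n‖ * ‖rising q n‖ * ‖rising r n‖)
      ≤ (‖z‖ ^ 2 * t ^ 2) ^ n / (n.factorial * (m₁ ^ n * n.factorial) * (m₂ ^ n * n.factorial) *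
          (m₃ ^ n * 1)) := by
        gcongr
        · exact h₁ n
        · exact h₂ n
        · refine le_trans ?_ (h₃ n)
          gcongr
    _ = ((n.factorial : ℝ) ^ 2)⁻¹ * (X ^ n / n.factorial) * (ε * t / 2) ^ (2 * n) := by
        rw [hX, pow_mul (ε * t / 2)]
        field_simp
        simp only [mul_pow, div_pow, ← pow_mul]
        field_simp
        have h4 : (4 : ℝ) ^ n = 2 ^ (2 * n) := by rw [pow_mul]; norm_num
        rw [h4]
    _ ≤ 2 ^ (2 * n) / (2 * n).factorial * Real.exp X * (ε * t / 2) ^ (2 * n) := by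
        have : 0 ≤ (ε * t / 2) ^ (2 * n) := (even_two_mul n).pow_nonneg _
        have hX0 : 0 ≤ X := by positivity
        gcongr
        · exact inv_factorial_sq_le n
        · exact Real.pow_div_factorial_le_exp X hX0 n
    _ = _ := by
        rw [div_pow]
        field_simp

/-! ### The double integral -/

theorem integrableOn_rpow_mul_exp_neg_add_div {t δ : ℝ} (ht : 0 < t) (hδ : 0 < δ) (a : ℝ) :
    IntegrableOn (fun s : ℝ => s ^ a * Real.exp (-(δ * (s + t ^ 2 / s)))) (Set.Ioi 0) := by
  -- Near `0` the factor `exp (-δ t² / s)` is at most a constant multiple of `s^N`.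
  obtain ⟨N, hN⟩ := exists_nat_gt (-a - 1)
  have h := (integrableOn_rpow_mul_exp_neg_mul_rpow (p := 1) (s := a + N) (b := δ) (by linarith)
    one_pos hδ).const_mul (N.factorial / (δ * t ^ 2) ^ N)
  refine Integrable.mono' h (by fun_prop) ((ae_restrict_iff' measurableSet_Ioi).mpr
    (Filter.Eventually.of_forall fun s hs => ?_))
  have hs : 0 < s := hs
  rw [Real.norm_of_nonneg (by positivity), Real.rpow_one, Real.rpow_add_natCast hs.ne']
  have hx := Real.pow_div_factorial_le_exp (δ * t ^ 2 / s) (by positivity) N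
  have hx' : Real.exp (-(δ * t ^ 2 / s)) ≤ N.factorial / (δ * t ^ 2) ^ N * s ^ N := by
    rw [Real.exp_neg]
    refine (inv_anti₀ (by positivity) hx).trans_eq ?_
    rw [div_pow]
    field_simp
  calc s ^ a * Real.exp (-(δ * (s + t ^ 2 / s)))
      = s ^ a * (Real.exp (-δ * s) * Real.exp (-(δ * t ^ 2 / s))) := by
        rw [← Real.exp_add]; ring_nf
    _ ≤ s ^ a * (Real.exp (-δ * s) * (N.factorial / (δ * t ^ 2) ^ N * s ^ N)) := by gcongr
    _ = _ := by ring

theorem norm_ofReal_cpow {x : ℝ} (hx : 0 < x) (a : ℂ) : ‖(x : ℂ) ^ a‖ = x ^ a.re :=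
  Complex.norm_cpow_eq_rpow_re_of_pos hx a

theorem integrableOn_cpow_mul_exp_neg_add_div {t : ℝ} (ht : 0 < t) (μ : ℂ) :
    IntegrableOn (fun s : ℝ => (s : ℂ) ^ (μ - 1) * Complex.exp (-(s + t ^ 2 / s))) (Set.Ioi 0) := by
  refine Integrable.mono' (integrableOn_rpow_mul_exp_neg_add_div ht one_pos (μ.re - 1))
    (by fun_prop) ((ae_restrict_iff' measurableSet_Ioi).mpr
    (Filter.Eventually.of_forall fun s hs => ?_))
  rw [norm_mul, norm_ofReal_cpow hs, Complex.norm_exp, one_mul]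
  have : (-((s : ℂ) + t ^ 2 / s)).re = -(s + t ^ 2 / s) := by
    norm_cast
  rw [this]
  simp

/-- The substitution `s = t e^u` in the integral that defines `K_μ`. -/
theorem besselK_two_mul {t : ℝ} (ht : 0 < t) (μ : ℂ) :
    besselK μ (2 * (t : ℂ)) = 1 / 2 * (t : ℂ) ^ (-μ) *
      ∫ s in Set.Ioi (0 : ℝ), (s : ℂ) ^ (μ - 1) * Complex.exp (-(s + t ^ 2 / s)) := by
  have htc : (t : ℂ) ≠ 0 := by exact_mod_cast ht.ne'
  set φ : ℝ → ℝ := fun u => t * Real.exp u with hφ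
  have hφ' : ∀ u ∈ Set.univ, HasDerivWithinAt φ (t * Real.exp u) Set.univ u := fun u _ =>
    ((Real.hasDerivAt_exp u).const_mul t).hasDerivWithinAt
  have hinj : Set.InjOn φ Set.univ := fun u _ v _ h =>
    Real.exp_injective (mul_left_cancel₀ ht.ne' h)
  have himg : φ '' Set.univ = Set.Ioi 0 := by
    ext s
    simp only [Set.image_univ, Set.mem_range, Set.mem_Ioi, hφ]
    constructor
    · rintro ⟨u, rfl⟩
      positivity
    · intro hs
      exact ⟨Real.log (s / t), by rw [Real.exp_log (by positivity)]; field_simp⟩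
  set g : ℝ → ℂ := fun u => Complex.exp (μ * u) * Complex.exp (-(2 * t) * Complex.cosh u) with hg
  have hcomp (u : ℝ) : |t * Real.exp u| • (((φ u : ℝ) : ℂ) ^ (μ - 1) *
      Complex.exp (-((φ u : ℝ) + t ^ 2 / (φ u : ℝ)))) = (t : ℂ) ^ μ * g u := by
    have he : ((Real.exp u : ℝ) : ℂ) ≠ 0 := by exact_mod_cast (Real.exp_pos u).ne'
    have hp : ((φ u : ℝ) : ℂ) ^ μ = (t : ℂ) ^ μ * Complex.exp (μ * u) := by
      rw [hφ, Complex.ofReal_mul, Complex.mul_cpow_ofReal_nonneg ht.le (Real.exp_pos u).le,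
        Complex.cpow_def_of_ne_zero he, ← Complex.ofReal_log (Real.exp_pos u).le, Real.log_exp,
        mul_comm μ]
    have hφc : ((φ u : ℝ) : ℂ) ≠ 0 := by
      rw [hφ, Complex.ofReal_mul]
      exact mul_ne_zero htc he
    rw [abs_of_pos (by positivity), Complex.real_smul, ← mul_assoc, Complex.cpow_sub _ _ hφc,
      Complex.cpow_one, hp, hg]
    change (φ u : ℂ) * _ * _ = _
    rw [mul_div_cancel₀ _ hφc]
    have : -((φ u : ℂ) + t ^ 2 / (φ u : ℂ)) = -(2 * t) * Complex.cosh u := by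
      rw [hφ, Complex.cosh, Complex.exp_neg]
      push_cast at he ⊢
      field_simp
    rw [this]
    ring
  have hI := integral_image_eq_integral_abs_deriv_smul MeasurableSet.univ hφ' hinj
    (fun s : ℝ => (s : ℂ) ^ (μ - 1) * Complex.exp (-(s + t ^ 2 / s)))
  have hint := (integrableOn_image_iff_integrableOn_abs_deriv_smul MeasurableSet.univ hφ' hinj
    (fun s : ℝ => (s : ℂ) ^ (μ - 1) * Complex.exp (-(s + t ^ 2 / s)))).mp
    (himg ▸ integrableOn_cpow_mul_exp_neg_add_div ht μ)
  rw [himg] at hI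
  simp_rw [hcomp] at hI hint
  have htμ : (t : ℂ) ^ μ ≠ 0 := by simp [Complex.cpow_eq_zero_iff, htc]
  have hgi : Integrable g := by
    have := hint.const_mul (((t : ℂ) ^ μ)⁻¹)
    simpa [← mul_assoc, inv_mul_cancel₀ htμ] using this
  rw [hI, setIntegral_univ, integral_const_mul, Complex.cpow_neg, mul_assoc,
    inv_mul_cancel_left₀ htμ,
    ← intervalIntegral.integral_Iic_add_Ioi hgi.integrableOn hgi.integrableOn (b := 0)]
  have hneg := integral_comp_neg_Ioi (0 : ℝ) g
  rw [neg_zero] at hneg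
  rw [← hneg, ← integral_add hgi.comp_neg.integrableOn hgi.integrableOn, ← integral_const_mul,
    besselK]
  refine integral_congr_ae (Filter.Eventually.of_forall fun u => ?_)
  simp only [hg, Complex.ofReal_neg, Complex.cosh_neg, mul_neg]
  rw [show Complex.cosh (μ * u) = (Complex.exp (μ * u) + Complex.exp (-(μ * u))) / 2 from rfl]
  ring

/-- The majorant of the double integral. Integrating over `t` first leaves a multiple of
`s^((a+1)/2 + b - 1) exp (-δ s)`, which explains the hypothesis `hab`. -/
theorem integrable_prod_rpow_mul_exp_neg_add_div {a b δ : ℝ} (hδ : 0 < δ) (ha : -1 < a)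
    (hab : 0 < (a + 1) / 2 + b) :
    Integrable (fun p : ℝ × ℝ => p.1 ^ a * p.2 ^ (b - 1) * Real.exp (-(δ * (p.2 + p.1 ^ 2 / p.2))))
      ((volume.restrict (Set.Ioi 0)).prod (volume.restrict (Set.Ioi 0))) := by
  have hsplit (t s : ℝ) : t ^ a * s ^ (b - 1) * Real.exp (-(δ * (s + t ^ 2 / s))) =
      s ^ (b - 1) * Real.exp (-δ * s) * (t ^ a * Real.exp (-(δ / s) * t ^ 2)) := by
    rw [show -(δ * (s + t ^ 2 / s)) = -δ * s + -(δ / s) * t ^ 2 by ring, Real.exp_add]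
    ring
  rw [integrable_prod_iff' (by fun_prop)]
  refine ⟨(ae_restrict_iff' measurableSet_Ioi).mpr (Filter.Eventually.of_forall fun s hs => ?_), ?_⟩
  · have hs : 0 < s := hs
    simp_rw [hsplit]
    exact (integrableOn_rpow_mul_exp_neg_mul_sq (div_pos hδ hs) ha).const_mul _
  · have h := (integrableOn_rpow_mul_exp_neg_mul_rpow (p := 1) (s := (a + 1) / 2 + b - 1) (b := δ)
      (by linarith) one_pos hδ).const_mul (δ ^ (-(a + 1) / 2) * (1 / 2) * Real.Gamma ((a + 1) / 2))
    refine h.congr ((ae_restrict_iff' measurableSet_Ioi).mpr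
      (Filter.Eventually.of_forall fun s hs => ?_))
    have hs : 0 < s := hs
    have hI : ∫ t in Set.Ioi (0 : ℝ), ‖t ^ a * s ^ (b - 1) * Real.exp (-(δ * (s + t ^ 2 / s)))‖ =
        s ^ (b - 1) * Real.exp (-δ * s) *
          ((δ / s) ^ (-(a + 1) / 2) * (1 / 2) * Real.Gamma ((a + 1) / 2)) := by
      rw [← integral_rpow_mul_exp_neg_mul_rpow two_pos ha (div_pos hδ hs), ← integral_const_mul]
      refine setIntegral_congr_fun measurableSet_Ioi fun t ht => ?_
      have ht : 0 < t := ht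
      rw [Real.norm_of_nonneg (by positivity), hsplit, Real.rpow_two]
    simp only
    rw [hI, Real.div_rpow hδ.le hs.le, Real.rpow_one,
      show (a + 1) / 2 + b - 1 = (b - 1) + (a + 1) / 2 by ring, Real.rpow_add hs,
      show -(a + 1) / 2 = -((a + 1) / 2) by ring, Real.rpow_neg hs.le, div_inv_eq_mul]
    ring

/-- Absolute convergence of the double integral: `2 γ t ≤ γ (s + t² / s)` leaves the
positive multiple `(1 - γ) (s + t² / s)` of the exponent. -/
theorem integrable_prod_mul_cpow {h : ℝ → ℂ} (hm : Measurable h) {C γ : ℝ} (hγ0 : 0 ≤ γ)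
    (hγ : γ < 1) (hC : 0 ≤ C) (hle : ∀ t : ℝ, 0 < t → ‖h t‖ ≤ C * Real.exp (2 * γ * t)) {μ ν : ℂ}
    (hν : -1 < ν.re) (hμν : -1 < (μ + ν).re) :
    Integrable (fun p : ℝ × ℝ => h p.1 * (p.1 : ℂ) ^ (2 * ν + 1) *
      ((p.2 : ℂ) ^ (μ - 1) * Complex.exp (-(p.2 + p.1 ^ 2 / p.2))))
      ((volume.restrict (Set.Ioi 0)).prod (volume.restrict (Set.Ioi 0))) := by
  rw [Complex.add_re] at hμν
  have hG := (integrable_prod_rpow_mul_exp_neg_add_div (a := 2 * ν.re + 1) (b := μ.re)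
    (sub_pos.mpr hγ) (by linarith) (by linarith)).const_mul C
  refine Integrable.mono' hG (by fun_prop) ?_
  rw [Measure.prod_restrict, ae_restrict_iff' (measurableSet_Ioi.prod measurableSet_Ioi)]
  refine Filter.Eventually.of_forall fun ⟨t, s⟩ ⟨ht, hs⟩ => ?_
  have ht : 0 < t := ht
  have hs : 0 < s := hs
  have hre : (-((s : ℂ) + t ^ 2 / s)).re = -(s + t ^ 2 / s) := by norm_cast
  have hre' : (2 * ν + 1).re = 2 * ν.re + 1 := by simp
  simp only [norm_mul, norm_ofReal_cpow ht, norm_ofReal_cpow hs, Complex.norm_exp, hre, hre',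
    Complex.sub_re, Complex.one_re]
  have amgm : 2 * γ * t ≤ γ * (s + t ^ 2 / s) := by
    have : s + t ^ 2 / s - 2 * t = (s - t) ^ 2 / s := by field_simp; ring
    have : 0 ≤ (s - t) ^ 2 / s := by positivity
    nlinarith
  calc ‖h t‖ * t ^ (2 * ν.re + 1) * (s ^ (μ.re - 1) * Real.exp (-(s + t ^ 2 / s)))
      ≤ C * Real.exp (γ * (s + t ^ 2 / s)) * t ^ (2 * ν.re + 1) *
          (s ^ (μ.re - 1) * Real.exp (-(s + t ^ 2 / s))) := by
        gcongr
        exact (hle t ht).trans (by gcongr)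
    _ = C * (t ^ (2 * ν.re + 1) * s ^ (μ.re - 1) *
          (Real.exp (γ * (s + t ^ 2 / s)) * Real.exp (-(s + t ^ 2 / s)))) := by ring
    _ = _ := by
        rw [← Real.exp_add]
        ring_nf

theorem setIntegral_mul_cpow_eq {t : ℝ} (ht : 0 < t) (y μ ν : ℂ) :
    ∫ s in Set.Ioi (0 : ℝ), y * (t : ℂ) ^ (2 * ν + 1) *
      ((s : ℂ) ^ (μ - 1) * Complex.exp (-(s + t ^ 2 / s))) =
    2 * (y * ((t : ℂ) ^ (μ + 2 * ν + 1) * besselK μ (2 * (t : ℂ)))) := by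
  have htc : (t : ℂ) ≠ 0 := by exact_mod_cast ht.ne'
  have : (t : ℂ) ^ (2 * ν + 1) = (t : ℂ) ^ (μ + 2 * ν + 1) * (t : ℂ) ^ (-μ) := by
    rw [← Complex.cpow_add _ _ htc]
    ring_nf
  rw [integral_const_mul, besselK_two_mul ht, this]
  ring

theorem integrableOn_mul_besselK {h : ℝ → ℂ} (hm : Measurable h) {C γ : ℝ} (hγ0 : 0 ≤ γ)
    (hγ : γ < 1) (hC : 0 ≤ C) (hle : ∀ t : ℝ, 0 < t → ‖h t‖ ≤ C * Real.exp (2 * γ * t)) {μ ν : ℂ}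
    (hν : -1 < ν.re) (hμν : -1 < (μ + ν).re) :
    IntegrableOn (fun t : ℝ => h t * ((t : ℂ) ^ (μ + 2 * ν + 1) * besselK μ (2 * (t : ℂ))))
      (Set.Ioi 0) := by
  have hint := (integrable_prod_mul_cpow hm hγ0 hγ hC hle hν hμν).integral_prod_left.const_mul
    (1 / 2 : ℂ)
  refine hint.congr ((ae_restrict_iff' measurableSet_Ioi).mpr (Filter.Eventually.of_forall
    fun t ht => ?_))
  simp only
  rw [setIntegral_mul_cpow_eq ht]
  ring

/-- Fubini's theorem for the double integral that represents `K_μ`. -/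
theorem setIntegral_mul_besselK {h : ℝ → ℂ} (hm : Measurable h) {C γ : ℝ} (hγ0 : 0 ≤ γ)
    (hγ : γ < 1) (hC : 0 ≤ C) (hle : ∀ t : ℝ, 0 < t → ‖h t‖ ≤ C * Real.exp (2 * γ * t)) {μ ν : ℂ}
    (hν : -1 < ν.re) (hμν : -1 < (μ + ν).re) :
    ∫ t in Set.Ioi (0 : ℝ), h t * ((t : ℂ) ^ (μ + 2 * ν + 1) * besselK μ (2 * (t : ℂ))) =
      1 / 2 * ∫ s in Set.Ioi (0 : ℝ), (s : ℂ) ^ (μ - 1) * Complex.exp (-s) *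
        ∫ t in Set.Ioi (0 : ℝ), h t * (t : ℂ) ^ (2 * ν + 1) * Complex.exp (-(t ^ 2 / s)) := by
  have hswap := integral_integral_swap
    (f := fun t s : ℝ => h t * (t : ℂ) ^ (2 * ν + 1) *
      ((s : ℂ) ^ (μ - 1) * Complex.exp (-(s + t ^ 2 / s))))
    (integrable_prod_mul_cpow hm hγ0 hγ hC hle hν hμν)
  rw [setIntegral_congr_fun measurableSet_Ioi fun t ht => setIntegral_mul_cpow_eq ht (h t) μ ν,
    integral_const_mul] at hswap
  rw [← mul_right_inj' (two_ne_zero (α := ℂ)), hswap, ← mul_assoc, mul_one_div_cancel two_ne_zero,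
    one_mul]
  refine integral_congr_ae (Filter.Eventually.of_forall fun s => ?_)
  simp only
  rw [← integral_const_mul]
  refine integral_congr_ae (Filter.Eventually.of_forall fun t => ?_)
  simp only
  rw [neg_add, Complex.exp_add]
  ring

/-! ### Integration over `t` -/

/-- Euler's integral after the substitution `y = t²`. -/
theorem setIntegral_cpow_mul_exp_neg_sq_div {s : ℝ} (hs : 0 < s) {a : ℂ} (ha : 0 < a.re) :
    ∫ t in Set.Ioi (0 : ℝ), (t : ℂ) ^ (2 * a - 1) * Complex.exp (-(t ^ 2 / s)) =
      1 / 2 * (Complex.Gamma a * (s : ℂ) ^ a) := by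
  have h1 := Complex.integral_cpow_mul_exp_neg_mul_Ioi ha (r := (1 / s : ℝ)) (by simpa using hs)
  rw [← integral_comp_rpow_Ioi_of_pos two_pos] at h1
  have h2 : (1 / ((1 / s : ℝ) : ℂ)) = s := by push_cast; simp
  rw [h2] at h1
  rw [mul_comm (Complex.Gamma a), ← h1, ← integral_const_mul]
  refine setIntegral_congr_fun measurableSet_Ioi fun t ht => ?_
  have ht : 0 < t := ht
  have htc : (t : ℂ) ≠ 0 := by exact_mod_cast ht.ne'
  have hpow : (((t ^ 2 : ℝ) : ℂ)) ^ (a - 1) * t = (t : ℂ) ^ (2 * a - 1) := by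
    rw [sq, Complex.ofReal_mul, Complex.mul_cpow_ofReal_nonneg ht.le ht.le,
      ← Complex.cpow_add _ _ htc]
    nth_rewrite 2 [← Complex.cpow_one (t : ℂ)]
    rw [← Complex.cpow_add _ _ htc]
    ring_nf
  simp only [Real.rpow_two, Complex.real_smul]
  rw [← hpow, show (2 : ℝ) - 1 = 1 by norm_num, Real.rpow_one]
  push_cast
  ring_nf

/-- A Gaussian absorbs exponential growth: `L t ≤ s L² / 2 + t² / (2 s)`. -/
theorem integrableOn_rpow_mul_exp_mul_exp_neg_sq_div {s : ℝ} (hs : 0 < s) {a : ℝ} (ha : -1 < a)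
    (L : ℝ) :
    IntegrableOn (fun t : ℝ => t ^ a * Real.exp (L * t) * Real.exp (-(t ^ 2 / s))) (Set.Ioi 0) := by
  have h := (integrableOn_rpow_mul_exp_neg_mul_sq (b := 1 / (2 * s)) (by positivity) ha).const_mul
    (Real.exp (s * L ^ 2 / 2))
  refine Integrable.mono' h (by fun_prop) ((ae_restrict_iff' measurableSet_Ioi).mpr
    (Filter.Eventually.of_forall fun t ht => ?_))
  have ht : 0 < t := ht
  rw [Real.norm_of_nonneg (by positivity), mul_assoc, ← Real.exp_add, mul_left_comm, ← Real.exp_add]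
  refine mul_le_mul_of_nonneg_left (Real.exp_le_exp.mpr ?_) (by positivity)
  have : s * L ^ 2 / 2 + -(1 / (2 * s)) * t ^ 2 - (L * t + -(t ^ 2 / s)) =
      (s * L - t) ^ 2 / (2 * s) := by field_simp; ring
  have : 0 ≤ (s * L - t) ^ 2 / (2 * s) := by positivity
  linarith

theorem hasSum_pow_div_factorial_mul_descFactorial (y : ℂ) (j : ℕ) :
    HasSum (fun k : ℕ => y ^ k / k.factorial * (k.descFactorial j : ℂ))
      (y ^ j * Complex.exp y) := by
  rw [← hasSum_nat_add_iff' j, Finset.sum_eq_zero, sub_zero]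
  · have h := (NormedSpace.expSeries_div_hasSum_exp y).mul_left (y ^ j)
    rw [← Complex.exp_eq_exp_ℂ] at h
    convert! h using 2 with i
    have h1 : ((i.factorial : ℂ)) * ((i + j).descFactorial j : ℂ) = (i + j).factorial := by
      have := Nat.factorial_mul_descFactorial (n := i + j) (k := j) (by omega)
      rw [Nat.add_sub_cancel] at this
      exact_mod_cast this
    have n1 : (i.factorial : ℂ) ≠ 0 := by exact_mod_cast i.factorial_ne_zero
    have n2 : ((i + j).factorial : ℂ) ≠ 0 := by exact_mod_cast (i + j).factorial_ne_zero
    rw [← mul_div_assoc, div_mul_eq_mul_div, div_eq_div_iff n2 n1, ← h1]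
    ring
  · intro k hk
    rw [Nat.descFactorial_of_lt (Finset.mem_range.mp hk)]
    simp

/-- The Chu–Vandermonde identity with `B = -k`: the expansion of `(a + k)_n` in falling factorials
of `k`. -/
theorem rising_add_nat_eq_sum (a : ℂ) (n k : ℕ) :
    rising (a + k) n = ∑ j ∈ Finset.range (n + 1),
      (n.choose j : ℂ) * rising (a + j) (n - j) * (k.descFactorial j : ℂ) := by
  have h := sum_choose_mul_rising n (-(k : ℂ)) a
  rw [sub_neg_eq_add] at h
  rw [← h]
  refine Finset.sum_congr rfl fun j _ => ?_
  have : (-1 : ℂ) ^ j * rising (-(k : ℂ)) j = (k.descFactorial j : ℂ) := by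
    rw [rising, ascPochhammer_eval_neg_eq_descPochhammer, descPochhammer_eval_eq_descFactorial,
      ← mul_assoc, ← mul_pow]
    simp
  rw [← this]
  ring

/-- Kummer's transformation `₁F₁(a + n; a; y) = e^y ₁F₁(-n; a; -y)`, multiplied by `(a)_n`. -/
theorem hasSum_pow_div_factorial_mul_rising (a y : ℂ) (n : ℕ) :
    HasSum (fun k : ℕ => y ^ k / k.factorial * rising (a + k) n)
      (Complex.exp y * ∑ j ∈ Finset.range (n + 1),
        (n.choose j : ℂ) * rising (a + j) (n - j) * y ^ j) := by
  have h := hasSum_sum (s := Finset.range (n + 1)) fun j _ =>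
    (hasSum_pow_div_factorial_mul_descFactorial y j).mul_left
      ((n.choose j : ℂ) * rising (a + j) (n - j))
  convert! h using 1
  · ext k
    rw [rising_add_nat_eq_sum, Finset.mul_sum]
    exact Finset.sum_congr rfl fun j _ => by ring
  · rw [Finset.mul_sum]
    exact Finset.sum_congr rfl fun j _ => by ring

/-- The integral over `t` for fixed `s`: termwise integration of `E_ν` yields the series
`₁F₁(ν+1+n; ν+1; c²s)`, which Kummer's transformation sums. -/
theorem setIntegral_besselE_mul_exp_neg_sq_div {s : ℝ} (hs : 0 < s) {ν : ℂ} (hν : -1 < ν.re)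
    (c : ℂ) (n : ℕ) :
    ∫ t in Set.Ioi (0 : ℝ), (t : ℂ) ^ (2 * n) * besselE ν (c * t) * (t : ℂ) ^ (2 * ν + 1) *
        Complex.exp (-(t ^ 2 / s)) =
      1 / 2 * ((s : ℂ) ^ (ν + 1 + n) * (Complex.exp (c ^ 2 * s) *
        ∑ j ∈ Finset.range (n + 1),
          (n.choose j : ℂ) * rising (ν + 1 + j) (n - j) * (c ^ 2 * s) ^ j)) := by
  have hsc : (s : ℂ) ≠ 0 := by exact_mod_cast hs.ne'
  have hν1 : ∀ k : ℕ, ν + 1 ≠ -k := ne_neg_nat_of_re_pos (by simp; linarith)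
  obtain ⟨C, B, hC, hB, hCB⟩ := exists_norm_besselE_term_le hν1
  set F : ℕ → ℝ → ℂ := fun k t => c ^ (2 * k) *
    ((Nat.factorial k : ℂ) * Complex.Gamma (ν + (k : ℂ) + 1))⁻¹ *
    ((t : ℂ) ^ (2 * (ν + 1 + n + k) - 1) * Complex.exp (-(t ^ 2 / s))) with hF
  have hF' (k : ℕ) {t : ℝ} (ht : 0 < t) : F k t = (c * t) ^ (2 * k) *
      ((Nat.factorial k : ℂ) * Complex.Gamma (ν + (k : ℂ) + 1))⁻¹ *
      ((t : ℂ) ^ (2 * n) * (t : ℂ) ^ (2 * ν + 1) * Complex.exp (-(t ^ 2 / s))) := by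
    have htc : (t : ℂ) ≠ 0 := by exact_mod_cast ht.ne'
    rw [hF]
    simp only
    rw [show 2 * (ν + 1 + n + k) - 1 = (2 * ν + 1) + ((2 * n : ℕ) : ℂ) + ((2 * k : ℕ) : ℂ) by
      push_cast; ring, Complex.cpow_add _ _ htc, Complex.cpow_add _ _ htc, Complex.cpow_natCast,
      Complex.cpow_natCast, mul_pow]
    ring
  have hsum : HasSum (fun k => ∫ t in Set.Ioi (0 : ℝ), F k t)
      (∫ t in Set.Ioi (0 : ℝ), (t : ℂ) ^ (2 * n) * besselE ν (c * t) * (t : ℂ) ^ (2 * ν + 1) *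
        Complex.exp (-(t ^ 2 / s))) := by
    refine hasSum_integral_of_dominated_convergence
      (fun k t => C * ((B * ‖c‖ * t) ^ (2 * k) / (2 * k).factorial) *
        (t ^ (2 * ν.re + 1 + 2 * n) * Real.exp (-(t ^ 2 / s)))) (fun k => by fun_prop) ?_ ?_ ?_ ?_
    · refine fun k => (ae_restrict_iff' measurableSet_Ioi).mpr (Filter.Eventually.of_forall
        fun t ht => ?_)
      have ht : 0 < t := ht
      have hre : (-((t : ℂ) ^ 2 / s)).re = -(t ^ 2 / s) := by norm_cast
      have hre' : (2 * ν + 1).re = 2 * ν.re + 1 := by simp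
      have hn : ‖(c : ℂ) * t‖ = ‖c‖ * t := by
        rw [norm_mul, Complex.norm_real, Real.norm_of_nonneg ht.le]
      have hp : t ^ (2 * ν.re + 1 + 2 * n) = t ^ (2 * n) * t ^ (2 * ν.re + 1) := by
        rw [Real.rpow_add ht, mul_comm]
        norm_cast
      rw [hF' k ht, norm_mul, norm_mul (_ * _) (Complex.exp _), norm_mul (_ ^ _) (_ ^ _),
        Complex.norm_exp, hre, norm_ofReal_cpow ht, hre', norm_pow, Complex.norm_real,
        Real.norm_of_nonneg ht.le, hp]
      refine mul_le_mul_of_nonneg_right ?_ (by positivity)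
      rw [mul_assoc B, ← hn]
      exact hCB k _
    · exact Filter.Eventually.of_forall fun t =>
        ((summable_pow_two_mul_div_factorial _).mul_left C).mul_right _
    · simp_rw [tsum_mul_right, tsum_mul_left, ← Real.cosh_eq_tsum]
      have h := (integrableOn_rpow_mul_exp_mul_exp_neg_sq_div hs (a := 2 * ν.re + 1 + 2 * n)
        (by have : (0 : ℝ) ≤ n := n.cast_nonneg
            linarith) (B * ‖c‖)).const_mul C
      refine Integrable.mono' h (by fun_prop) ((ae_restrict_iff' measurableSet_Ioi).mpr
        (Filter.Eventually.of_forall fun t ht => ?_))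
      have ht : 0 < t := ht
      have hcosh : 0 < Real.cosh (B * ‖c‖ * t) := Real.cosh_pos _
      have hle := tsum_pow_two_mul_div_factorial_le (B * ‖c‖ * t)
      rw [← Real.cosh_eq_tsum, abs_of_nonneg (by positivity)] at hle
      rw [Real.norm_of_nonneg (by positivity)]
      calc _ ≤ C * Real.exp (B * ‖c‖ * t) *
            (t ^ (2 * ν.re + 1 + 2 * n) * Real.exp (-(t ^ 2 / s))) := by gcongr
        _ = _ := by ring
    · refine (ae_restrict_iff' measurableSet_Ioi).mpr (Filter.Eventually.of_forall fun t ht => ?_)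
      simp_rw [hF' _ ht]
      convert! (hasSum_besselE hν1 (c * t)).mul_right
        ((t : ℂ) ^ (2 * n) * (t : ℂ) ^ (2 * ν + 1) * Complex.exp (-(t ^ 2 / s))) using 1
      ring
  refine hsum.unique ?_
  convert! ((hasSum_pow_div_factorial_mul_rising (ν + 1) (c ^ 2 * s) n).mul_left
    ((s : ℂ) ^ (ν + 1 + n))).mul_left (1 / 2 : ℂ) using 2 with k
  have hre : 0 < (ν + 1 + n + k).re := by
    have : (0 : ℝ) ≤ n := n.cast_nonneg
    have : (0 : ℝ) ≤ k := k.cast_nonneg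
    simp
    linarith
  have hνk : ∀ i : ℕ, ν + 1 + k ≠ -i := ne_neg_nat_of_re_pos (by
    have : (0 : ℝ) ≤ k := k.cast_nonneg
    simp
    linarith)
  have hG : Complex.Gamma (ν + 1 + n + k) = Complex.Gamma (ν + k + 1) * rising (ν + 1 + k) n := by
    rw [show ν + 1 + n + k = ν + 1 + k + n by ring, Gamma_add_nat_eq_rising hνk]
    ring_nf
  have hG0 : Complex.Gamma (ν + k + 1) ≠ 0 := by
    rw [show ν + k + 1 = ν + 1 + k by ring]
    exact Complex.Gamma_ne_zero hνk
  rw [hF]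
  simp only
  rw [integral_const_mul, setIntegral_cpow_mul_exp_neg_sq_div hs hre, hG, Complex.cpow_add _ _ hsc,
    Complex.cpow_natCast, mul_pow, ← pow_mul]
  field_simp

/-! ### Integration over `s` -/

theorem integrableOn_cpow_mul_exp_neg_mul {a q : ℂ} (ha : -1 < a.re) (hq : 0 < q.re) :
    IntegrableOn (fun s : ℝ => (s : ℂ) ^ a * Complex.exp (-(q * s))) (Set.Ioi 0) := by
  refine Integrable.mono' (integrableOn_rpow_mul_exp_neg_mul_rpow ha one_pos hq) (by fun_prop)
    ((ae_restrict_iff' measurableSet_Ioi).mpr (Filter.Eventually.of_forall fun s hs => ?_))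
  rw [norm_mul, norm_ofReal_cpow hs, Complex.norm_exp, Real.rpow_one]
  simp

/-- Euler's integral with a complex rate, by analytic continuation from positive rates. -/
theorem setIntegral_cpow_mul_exp_neg_mul {a q : ℂ} (ha : 0 < a.re) (hq : 0 < q.re) :
    ∫ s in Set.Ioi (0 : ℝ), (s : ℂ) ^ (a - 1) * Complex.exp (-(q * s)) =
      Complex.Gamma a * (q ^ a)⁻¹ := by
  set U : Set ℂ := {w : ℂ | 0 < w.re} with hU
  have hUo : IsOpen U := isOpen_lt continuous_const Complex.continuous_re
  have hL : DifferentiableOn ℂ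
      (fun w : ℂ => ∫ s in Set.Ioi (0 : ℝ), (s : ℂ) ^ (a - 1) * Complex.exp (-(w * s))) U := by
    intro w hw
    have hw : 0 < w.re := hw
    have hd := hasDerivAt_integral_of_dominated_loc_of_deriv_le
      (μ := volume.restrict (Set.Ioi (0 : ℝ))) (x₀ := w) (s := Metric.ball w (w.re / 2))
      (F := fun (w : ℂ) (s : ℝ) => (s : ℂ) ^ (a - 1) * Complex.exp (-(w * s)))
      (F' := fun (w : ℂ) (s : ℝ) => (s : ℂ) ^ (a - 1) * (Complex.exp (-(w * s)) * -s))
      (bound := fun s => s ^ a.re * Real.exp (-(w.re / 2) * s ^ (1 : ℝ)))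
      (Metric.ball_mem_nhds w (half_pos hw)) (Filter.Eventually.of_forall fun w => by fun_prop)
      (integrableOn_cpow_mul_exp_neg_mul (by simpa using ha) hw) (by fun_prop)
      ((ae_restrict_iff' measurableSet_Ioi).mpr (Filter.Eventually.of_forall fun s hs v hv => ?_))
      (integrableOn_rpow_mul_exp_neg_mul_rpow (by linarith) one_pos (half_pos hw))
      (Filter.Eventually.of_forall fun s v _ => ?_)
    · exact hd.2.differentiableAt.differentiableWithinAt
    · have hs : 0 < s := hs
      have hv : w.re / 2 ≤ v.re := by
        have h1 := Complex.abs_re_le_norm (v - w)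
        rw [Metric.mem_ball, dist_eq_norm] at hv
        rw [Complex.sub_re] at h1
        linarith [neg_abs_le (v.re - w.re)]
      have hre : (-(v * s)).re = -(v.re * s) := by simp
      rw [norm_mul, norm_mul, norm_neg, norm_ofReal_cpow hs, Complex.norm_exp, Complex.norm_real,
        Real.norm_of_nonneg hs.le, hre, Real.rpow_one, Complex.sub_re, Complex.one_re,
        Real.rpow_sub_one hs.ne']
      calc s ^ a.re / s * (Real.exp (-(v.re * s)) * s) = s ^ a.re * Real.exp (-(v.re * s)) := by
            field_simp
        _ ≤ _ := by
            gcongr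
            nlinarith
    · have h1 : HasDerivAt (fun v : ℂ => -(v * s)) (-(s : ℂ)) v := by
        simpa using ((hasDerivAt_id v).mul_const (s : ℂ)).fun_neg
      exact h1.cexp.const_mul _
  have hR : DifferentiableOn ℂ (fun w : ℂ => Complex.Gamma a * (w ^ a)⁻¹) U := by
    intro w hw
    have hw : 0 < w.re := hw
    have hw0 : w ≠ 0 := by rintro rfl; simp at hw
    have h1 : DifferentiableAt ℂ (fun w : ℂ => w ^ a) w :=
      differentiableAt_id.cpow_const (Or.inl hw)
    exact ((h1.inv (by simp [Complex.cpow_eq_zero_iff, hw0])).const_mul _).differentiableWithinAt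
  have hfreq : ∃ᶠ w in nhdsWithin (1 : ℂ) {1}ᶜ,
      ∫ s in Set.Ioi (0 : ℝ), (s : ℂ) ^ (a - 1) * Complex.exp (-(w * s)) =
        Complex.Gamma a * (w ^ a)⁻¹ := by
    have ht : Filter.Tendsto (fun r : ℝ => (r : ℂ))
        (nhdsWithin 1 {1}ᶜ) (nhdsWithin (1 : ℂ) {1}ᶜ) := by
      refine tendsto_nhdsWithin_of_tendsto_nhds_of_eventually_within _ ?_ ?_
      · exact (Complex.continuous_ofReal.tendsto' 1 1 (by simp)).mono_left nhdsWithin_le_nhds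
      · filter_upwards [self_mem_nhdsWithin] with r hr
        simpa using hr
    refine ht.frequently (Filter.Eventually.frequently ?_)
    filter_upwards [nhdsWithin_le_nhds (Ioi_mem_nhds (zero_lt_one' ℝ))] with r hr
    have hr : 0 < r := hr
    have harg : (r : ℂ).arg ≠ Real.pi := by
      rw [Complex.arg_ofReal_of_nonneg hr.le]
      exact Real.pi_pos.ne
    rw [Complex.integral_cpow_mul_exp_neg_mul_Ioi ha hr, one_div, Complex.inv_cpow _ _ harg,
      mul_comm]
  have hconv : IsPreconnected U := (convex_halfSpace_re_gt 0).isPreconnected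
  exact (hL.analyticOnNhd hUo).eqOn_of_preconnected_of_frequently_eq (hR.analyticOnNhd hUo) hconv
    (show (1 : ℂ) ∈ U by simp [hU]) hfreq hq

theorem exists_norm_besselE_mul_ofReal_le {ν : ℂ} (hν : -1 < ν.re) (c : ℂ) {η : ℝ} (hη : 0 < η) :
    ∃ C : ℝ, 0 ≤ C ∧ ∀ t : ℝ, 0 < t →
      ‖besselE ν (c * t)‖ ≤ C * Real.exp ((2 * |c.re| + η) * t) := by
  obtain ⟨C, hC, h⟩ := exists_norm_besselE_le hν
  refine ⟨C * (1 + 2 * ‖c‖ ^ 2 / η ^ 2), by positivity, fun t ht => (h _).trans ?_⟩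
  have hre : |(c * (t : ℂ)).re| = |c.re| * t := by
    rw [Complex.re_mul_ofReal, abs_mul, abs_of_pos ht]
  have h1 := Real.pow_div_factorial_le_exp (η * t) (by positivity) 2
  have h2 := Real.one_le_exp (show 0 ≤ η * t by positivity)
  have h3 : (‖c‖ * t) ^ 2 = 2 * ‖c‖ ^ 2 / η ^ 2 * ((η * t) ^ 2 / (Nat.factorial 2 : ℕ)) := by
    rw [Nat.factorial_two]
    push_cast
    field_simp
  rw [hre, norm_mul, Complex.norm_real, Real.norm_of_nonneg ht.le, ← mul_assoc 2 |c.re| t,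
    add_mul _ η t,
    Real.exp_add]
  calc C * ((1 + (‖c‖ * t) ^ 2) * Real.exp (2 * |c.re| * t))
      ≤ C * ((Real.exp (η * t) + 2 * ‖c‖ ^ 2 / η ^ 2 * Real.exp (η * t)) *
          Real.exp (2 * |c.re| * t)) := by
        rw [h3]
        gcongr
    _ = _ := by ring

theorem one_sub_sq_re_pos {c : ℂ} (hc : |c.re| < 1) : 0 < (1 - c ^ 2).re := by
  have h := abs_lt.mp hc
  rw [Complex.sub_re, sq, Complex.mul_re, Complex.one_re]
  nlinarith [mul_self_nonneg c.im]

/-- The moments `∫₀^∞ t^(μ+ν+1+2n) K_μ(2t) I_ν(2ct) dt` up to the factor `c^ν`. The strip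
`|Re c| < 1` is covered at once, since only `Re (1 - c²) > 0` is needed. -/
theorem setIntegral_pow_mul_besselE_mul_besselK {μ ν c : ℂ} (hν : -1 < ν.re)
    (hμν : -1 < (μ + ν).re) (hc : |c.re| < 1) (n : ℕ) :
    ∫ t in Set.Ioi (0 : ℝ), (t : ℂ) ^ (2 * n) * besselE ν (c * t) *
        ((t : ℂ) ^ (μ + 2 * ν + 1) * besselK μ (2 * (t : ℂ))) =
      1 / 4 * ∑ j ∈ Finset.range (n + 1),
        (n.choose j : ℂ) * rising (ν + 1 + j) (n - j) * (c ^ 2) ^ j *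
          (Complex.Gamma (μ + ν + 1 + n + j) * ((1 - c ^ 2) ^ (μ + ν + 1 + n + j))⁻¹) := by
  have hν1 : ∀ k : ℕ, ν + 1 ≠ -k := ne_neg_nat_of_re_pos (by simp; linarith)
  set η : ℝ := (1 - |c.re|) / 2 with hη
  have hη0 : 0 < η := by rw [hη]; linarith
  obtain ⟨C, hC, hE⟩ := exists_norm_besselE_mul_ofReal_le hν c hη0
  have hm : Measurable fun t : ℝ => (t : ℂ) ^ (2 * n) * besselE ν (c * t) := by
    have := measurable_besselE hν1
    fun_prop
  rw [setIntegral_mul_besselK hm (C := (2 * n).factorial / η ^ (2 * n) * C) (γ := |c.re| + η)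
    (by positivity) (by rw [hη]; linarith) (by positivity) (fun t ht => ?_) hν hμν]
  · have hinner : ∀ s ∈ Set.Ioi (0 : ℝ), (s : ℂ) ^ (μ - 1) * Complex.exp (-s) *
          ∫ t in Set.Ioi (0 : ℝ), (t : ℂ) ^ (2 * n) * besselE ν (c * t) * (t : ℂ) ^ (2 * ν + 1) *
            Complex.exp (-(t ^ 2 / s)) =
        1 / 2 * ∑ j ∈ Finset.range (n + 1),
          (n.choose j : ℂ) * rising (ν + 1 + j) (n - j) * (c ^ 2) ^ j *
            ((s : ℂ) ^ (μ + ν + 1 + n + j - 1) * Complex.exp (-((1 - c ^ 2) * s))) := by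
      intro s hs
      have hs : 0 < s := hs
      have hsc : (s : ℂ) ≠ 0 := by exact_mod_cast hs.ne'
      rw [setIntegral_besselE_mul_exp_neg_sq_div hs hν]
      simp only [Finset.mul_sum]
      refine Finset.sum_congr rfl fun j _ => ?_
      have hpow : (s : ℂ) ^ (μ + ν + 1 + n + j - 1) =
          (s : ℂ) ^ (μ - 1) * (s : ℂ) ^ (ν + 1 + n) * (s : ℂ) ^ j := by
        rw [← Complex.cpow_natCast, ← Complex.cpow_add _ _ hsc, ← Complex.cpow_add _ _ hsc]
        ring_nf
      rw [hpow, show -((1 - c ^ 2) * (s : ℂ)) = -s + c ^ 2 * s by ring, Complex.exp_add, mul_pow]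
      ring
    have hre (j : ℕ) : 0 < (μ + ν + 1 + n + j).re := by
      have : (0 : ℝ) ≤ n := n.cast_nonneg
      have : (0 : ℝ) ≤ j := j.cast_nonneg
      simp at hμν ⊢
      linarith
    rw [setIntegral_congr_fun measurableSet_Ioi hinner, integral_const_mul, integral_finsetSum,
      ← mul_assoc]
    · congr 1
      · norm_num
      · refine Finset.sum_congr rfl fun j _ => ?_
        rw [integral_const_mul, setIntegral_cpow_mul_exp_neg_mul (hre j) (one_sub_sq_re_pos hc)]
    · intro j _
      exact (integrableOn_cpow_mul_exp_neg_mul (by simpa using hre j)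
        (one_sub_sq_re_pos hc)).const_mul _
  · rw [norm_mul, norm_pow, Complex.norm_real, Real.norm_of_nonneg ht.le]
    have h1 := Real.pow_div_factorial_le_exp (η * t) (by positivity) (2 * n)
    have h2 : t ^ (2 * n) = (2 * n).factorial / η ^ (2 * n) *
        ((η * t) ^ (2 * n) / (2 * n).factorial) := by
      rw [mul_pow]
      field_simp
    calc t ^ (2 * n) * ‖besselE ν (c * t)‖
        ≤ (2 * n).factorial / η ^ (2 * n) * Real.exp (η * t) *
            (C * Real.exp ((2 * |c.re| + η) * t)) := by
          rw [h2]
          gcongr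
          exact hE t ht
      _ = (2 * n).factorial / η ^ (2 * n) * C *
            (Real.exp (η * t) * Real.exp ((2 * |c.re| + η) * t)) := by ring
      _ = _ := by
          rw [← Real.exp_add]
          ring_nf

/-! ### The product of two Bessel functions -/

theorem besselJ_eq_besselE (ν w : ℂ) :
    besselJ ν w = (w / 2) ^ ν * besselE ν (Complex.I * (w / 2)) := by
  rw [besselJ, besselE]
  congr 1
  refine tsum_congr fun k => ?_
  rw [mul_pow, pow_mul Complex.I, Complex.I_sq]

theorem mul_ofReal_cpow {c : ℂ} (hc : c ≠ 0) {t : ℝ} (ht : 0 < t) (r : ℂ) :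
    (c * t) ^ r = c ^ r * (t : ℂ) ^ r := by
  have htc : (t : ℂ) ≠ 0 := by exact_mod_cast ht.ne'
  rw [Complex.cpow_def_of_ne_zero (mul_ne_zero hc htc), Complex.cpow_def_of_ne_zero hc,
    Complex.cpow_def_of_ne_zero htc, mul_comm c, Complex.log_ofReal_mul ht hc, ← Complex.exp_add,
    Complex.ofReal_log ht.le]
  ring_nf

theorem besselI_two_mul {c : ℂ} (hc : c ≠ 0) {t : ℝ} (ht : 0 < t) (ν : ℂ) :
    besselI ν (2 * c * t) = c ^ ν * ((t : ℂ) ^ ν * besselE ν (c * t)) := by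
  rw [besselI, besselE, show 2 * c * (t : ℂ) / 2 = c * t by ring, mul_ofReal_cpow hc ht, mul_assoc]

/-- The Cauchy product of the two series. Its coefficients contain the polynomials
`₂F₁(-n, -μ-n; ν+1; c²)`. -/
theorem hasSum_besselE_mul_besselE {μ ν : ℂ} (hμ : ∀ k : ℕ, μ + 1 ≠ -k)
    (hν : ∀ k : ℕ, ν + 1 ≠ -k) (w c : ℂ) :
    HasSum (fun n : ℕ => w ^ (2 * n) / (n.factorial * rising (μ + 1) n * rising (ν + 1) n) *
      ∑ l ∈ Finset.range (n + 1), (n.choose l : ℂ) * rising (ν + 1 + l) (n - l) *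
        ((-1) ^ l * rising (ν + 1 - (μ + ν + 1 + n)) l) * (c ^ 2) ^ l)
      (Complex.Gamma (μ + 1) * Complex.Gamma (ν + 1) * (besselE μ w * besselE ν (c * w))) := by
  have sν := summable_norm_besselE hν (c * w)
  have sμ := summable_norm_besselE hμ w
  have hprod := (summable_norm_sum_mul_antidiagonal_of_summable_norm sν sμ).of_norm.hasSum
  rw [← tsum_mul_tsum_eq_tsum_sum_antidiagonal_of_summable_norm sν sμ, ← besselE,
    ← besselE] at hprod
  convert! hprod.mul_left (Complex.Gamma (μ + 1) * Complex.Gamma (ν + 1)) using 1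
  · ext n
    rw [Finset.Nat.sum_antidiagonal_eq_sum_range_succ_mk, Finset.mul_sum, Finset.mul_sum]
    refine Finset.sum_congr rfl fun l hl => ?_
    have hl : l ≤ n := Nat.lt_succ_iff.mp (Finset.mem_range.mp hl)
    obtain ⟨m, rfl⟩ := Nat.exists_eq_add_of_le hl
    -- The reflection of the rising factorial gives `(μ+1)_n / (μ+1)_(n-l)`.
    have href : (-1) ^ l * rising (ν + 1 - (μ + ν + 1 + (l + m : ℕ))) l = rising (μ + 1 + m) l := by
      rw [← rising_neg_reflect (μ + 1 + m) l]
      push_cast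
      ring_nf
    have hfac : ((l + m).factorial : ℂ) = ((l + m).choose l : ℂ) * l.factorial * m.factorial := by
      have := Nat.add_choose_mul_factorial_mul_factorial l m
      rw [← Nat.choose_symm_add] at this
      exact_mod_cast this.symm
    have hRν := rising_add (ν + 1) l m
    have hRμ := rising_add (μ + 1) m l
    rw [add_comm m l] at hRμ
    have n1 : rising (ν + 1) (l + m) ≠ 0 := rising_ne_zero hν _
    have n2 : rising (μ + 1) (l + m) ≠ 0 := rising_ne_zero hμ _
    have n3 : ((l + m).factorial : ℂ) ≠ 0 := by exact_mod_cast (l + m).factorial_ne_zero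
    rw [hRν] at n1
    rw [hRμ] at n2
    rw [hfac] at n3
    have g1 := Complex.Gamma_ne_zero hν
    have g2 := Complex.Gamma_ne_zero hμ
    simp only [Nat.add_sub_cancel_left]
    rw [href, hfac, hRν, hRμ, show ν + l + 1 = ν + 1 + l by ring,
      show μ + m + 1 = μ + 1 + m by ring, Gamma_add_nat_eq_rising hν, Gamma_add_nat_eq_rising hμ]
    simp only [mul_ne_zero_iff] at n1 n2 n3
    obtain ⟨n1, n1'⟩ := n1
    obtain ⟨n2, n2'⟩ := n2
    obtain ⟨⟨n3, n3'⟩, n3''⟩ := n3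
    generalize Complex.Gamma (μ + 1) = G at g2 ⊢
    generalize Complex.Gamma (ν + 1) = G' at g1 ⊢
    field_simp
    ring
  · ring

/-! ### The product as an integral -/

theorem mainTheorem1 (μ ν a b x z : ℂ)
    (hν : -1 < ν.re) (hμν : -1 < (μ + ν).re)
    (hμ : ∀ n : ℕ, μ ≠ -((n : ℂ) + 1))
    (ha : a ≠ 0) (hb : b ≠ 0) (hab : |(b / a).re| < 1)
    (hz : z = 1 / 2 * a * x * (1 - b ^ 2 / a ^ 2)) :
    MeasureTheory.IntegrableOn
      (fun t : ℝ => (t : ℂ) ^ (μ + ν + 1) *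
        hypergeometric0F3 (μ + 1) (ν + 1) (μ + ν + 1) (-z ^ 2 * (t : ℂ) ^ 2) *
        besselK μ (2 * (t : ℂ)) * besselI ν (2 * (b / a) * (t : ℂ)))
      (Set.Ioi (0 : ℝ)) ∧
    Complex.Gamma (μ + 1) * Complex.Gamma (ν + 1) * Complex.Gamma (μ + ν + 1) *
        besselJ μ (a * x) * besselJ ν (b * x) =
      4 * (1 / 2 * a * x) ^ μ * (1 / 2 * b * x) ^ ν *
        (1 - b ^ 2 / a ^ 2) ^ (μ + ν + 1) * (b / a) ^ (-ν) *
        ∫ t in Set.Ioi (0 : ℝ), (t : ℂ) ^ (μ + ν + 1) *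
          hypergeometric0F3 (μ + 1) (ν + 1) (μ + ν + 1) (-z ^ 2 * (t : ℂ) ^ 2) *
          besselK μ (2 * (t : ℂ)) * besselI ν (2 * (b / a) * (t : ℂ)) := by
  set c : ℂ := b / a with hc
  have hc0 : c ≠ 0 := div_ne_zero hb ha
  have hq : 1 - b ^ 2 / a ^ 2 = 1 - c ^ 2 := by rw [hc, div_pow]
  have hqre := one_sub_sq_re_pos hab
  have hq0 : 1 - c ^ 2 ≠ 0 := fun h => by rw [h] at hqre; simp at hqre
  rw [hq] at hz ⊢
  have hμ1 : ∀ k : ℕ, μ + 1 ≠ -k := fun k h => hμ k (by linear_combination h)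
  have hν1 : ∀ k : ℕ, ν + 1 ≠ -k := ne_neg_nat_of_re_pos (by simp; linarith)
  have hA1 : ∀ k : ℕ, μ + ν + 1 ≠ -k :=
    ne_neg_nat_of_re_pos (by rw [Complex.add_re, Complex.one_re]; linarith)
  -- `ε` is small enough for `₀F₃ · E_ν = O(exp (2γt))` with `2γ = 2|Re c| + 2ε < 2`.
  set ε : ℝ := (1 - |c.re|) / 2 with hε
  have hε0 : 0 < ε := by rw [hε]; linarith
  have hγ1 : |c.re| + ε < 1 := by rw [hε]; linarith
  obtain ⟨C₁, hC₁, hE⟩ := exists_norm_besselE_mul_ofReal_le hν c hε0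
  obtain ⟨C₂, hC₂, hF⟩ := exists_norm_hypergeometric0F3_term_le hμ1 hν1 hA1 z hε0
  set T : ℕ → ℝ → ℂ := fun n t => (-z ^ 2 * (t : ℂ) ^ 2) ^ n /
    ((Nat.factorial n : ℂ) * rising (μ + 1) n * rising (ν + 1) n * rising (μ + ν + 1) n) with hT
  set F : ℝ → ℂ := fun t =>
    hypergeometric0F3 (μ + 1) (ν + 1) (μ + ν + 1) (-z ^ 2 * (t : ℂ) ^ 2) with hFdef
  set w : ℝ → ℂ := fun t => (t : ℂ) ^ (μ + 2 * ν + 1) * besselK μ (2 * (t : ℂ)) with hw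
  have hTsum (t : ℝ) : HasSum (fun n => T n t) (F t) :=
    (Summable.of_norm_bounded ((summable_pow_two_mul_div_factorial (ε * t)).mul_left C₂)
      (fun n => hF n t)).hasSum
  have hFm : Measurable F :=
    measurable_of_tendsto_metrizable (f := fun N : ℕ => fun t : ℝ => ∑ n ∈ Finset.range N, T n t)
      (fun N => by fun_prop) (tendsto_pi_nhds.mpr fun t => (hTsum t).tendsto_sum_nat)
  have hEm : Measurable fun t : ℝ => besselE ν (c * t) := by
    have := measurable_besselE hν1
    fun_prop
  have hexp (t : ℝ) : Real.exp (ε * t) * Real.exp ((2 * |c.re| + ε) * t) =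
      Real.exp (2 * (|c.re| + ε) * t) := by
    rw [← Real.exp_add]
    ring_nf
  have hFle (t : ℝ) (ht : 0 < t) : ‖F t‖ ≤ C₂ * Real.exp (ε * t) := by
    have h1 := tsum_of_norm_bounded
      ((summable_pow_two_mul_div_factorial (ε * t)).mul_left C₂).hasSum (fun n => hF n t)
    rw [tsum_mul_left] at h1
    have h2 := tsum_pow_two_mul_div_factorial_le (ε * t)
    rw [abs_of_pos (by positivity)] at h2
    rw [← (hTsum t).tsum_eq]
    exact h1.trans (by gcongr)
  have hle (t : ℝ) (ht : 0 < t) : ‖F t * besselE ν (c * t)‖ ≤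
      C₂ * C₁ * Real.exp (2 * (|c.re| + ε) * t) := by
    rw [norm_mul, ← hexp]
    calc _ ≤ C₂ * Real.exp (ε * t) * (C₁ * Real.exp ((2 * |c.re| + ε) * t)) := by
          gcongr
          · exact hFle t ht
          · exact hE t ht
      _ = _ := by ring
  have hγ0 : 0 ≤ |c.re| + ε := by positivity
  have hint : IntegrableOn (fun t : ℝ => F t * besselE ν (c * t) * w t) (Set.Ioi 0) :=
    integrableOn_mul_besselK (hFm.mul hEm) hγ0 hγ1 (by positivity) hle hν hμν
  have heq : Set.EqOn (fun t : ℝ => c ^ ν * (F t * besselE ν (c * t) * w t))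
      (fun t : ℝ => (t : ℂ) ^ (μ + ν + 1) * F t * besselK μ (2 * (t : ℂ)) *
        besselI ν (2 * c * (t : ℂ))) (Set.Ioi 0) := by
    intro t ht
    have htc : (t : ℂ) ≠ 0 := by exact_mod_cast (show (0 : ℝ) < t from ht).ne'
    simp only [hw]
    rw [besselI_two_mul hc0 ht, show μ + 2 * ν + 1 = (μ + ν + 1) + ν by ring,
      Complex.cpow_add _ _ htc]
    ring
  have hint' : IntegrableOn (fun t : ℝ => c ^ ν * (F t * besselE ν (c * t) * w t)) (Set.Ioi 0) :=
    hint.const_mul (c ^ ν)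
  refine ⟨hint'.congr_fun heq measurableSet_Ioi, ?_⟩
  rw [← setIntegral_congr_fun measurableSet_Ioi heq, integral_const_mul]
  -- Termwise integration of the series of `₀F₃`.
  have hsum : HasSum (fun n => ∫ t in Set.Ioi (0 : ℝ), T n t * besselE ν (c * t) * w t)
      (∫ t in Set.Ioi (0 : ℝ), F t * besselE ν (c * t) * w t) := by
    have hdom := (integrableOn_mul_besselK
      (h := fun t => ((Real.exp (2 * (|c.re| + ε) * t) : ℝ) : ℂ)) (by fun_prop) hγ0 hγ1 zero_le_one
      (fun t _ => by
        rw [Complex.norm_real, Real.norm_of_nonneg (Real.exp_pos _).le, one_mul]) hν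
        hμν).norm.const_mul
      (C₂ * C₁)
    -- Measurability of `w` is read off from its integrability against `h = 1`.
    have hdom0 := integrableOn_mul_besselK (h := fun _ => 1) measurable_const le_rfl one_pos
      zero_le_one (fun t _ => by simp) hν hμν
    have hwm : AEStronglyMeasurable w (volume.restrict (Set.Ioi 0)) := by
      simpa using hdom0.aestronglyMeasurable
    refine hasSum_integral_of_dominated_convergence
      (fun n t => C₂ * ((ε * t) ^ (2 * n) / (2 * n).factorial) * (‖besselE ν (c * t)‖ * ‖w t‖))
      (fun n => ?_) (fun n => ?_) ?_ ?_ ?_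
    · have hTm : Measurable (T n) := by fun_prop
      exact (hTm.mul hEm).aestronglyMeasurable.mul hwm
    · refine Filter.Eventually.of_forall fun t => ?_
      rw [norm_mul, norm_mul, mul_assoc]
      exact mul_le_mul_of_nonneg_right (hF n t) (by positivity)
    · exact Filter.Eventually.of_forall fun t =>
        ((summable_pow_two_mul_div_factorial _).mul_left C₂).mul_right _
    · simp_rw [tsum_mul_right, tsum_mul_left, ← Real.cosh_eq_tsum]
      refine Integrable.mono' hdom ?_ ((ae_restrict_iff' measurableSet_Ioi).mpr
        (Filter.Eventually.of_forall fun t ht => ?_))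
      · have hcm : Measurable fun t : ℝ => C₂ * Real.cosh (ε * t) := by fun_prop
        exact hcm.aestronglyMeasurable.mul (hEm.norm.aestronglyMeasurable.mul hwm.norm)
      · have ht : 0 < t := ht
        have hcosh : 0 < Real.cosh (ε * t) := Real.cosh_pos _
        have h2 := tsum_pow_two_mul_div_factorial_le (ε * t)
        rw [abs_of_pos (by positivity), ← Real.cosh_eq_tsum] at h2
        have hnn : 0 ≤ C₂ * Real.cosh (ε * t) * (‖besselE ν (c * t)‖ * ‖w t‖) := by positivity
        rw [Real.norm_of_nonneg hnn]
        calc _ ≤ C₂ * Real.exp (ε * t) *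
              (C₁ * Real.exp ((2 * |c.re| + ε) * t) * ‖w t‖) := by
              gcongr
              exact hE t ht
          _ = C₂ * C₁ * ‖((Real.exp (2 * (|c.re| + ε) * t) : ℝ) : ℂ) * w t‖ := by
              rw [norm_mul ((Real.exp (2 * (|c.re| + ε) * t) : ℝ) : ℂ), Complex.norm_real,
                Real.norm_of_nonneg (Real.exp_pos _).le, ← hexp]
              ring
    · exact Filter.Eventually.of_forall fun t => ((hTsum t).mul_right _).mul_right _
  have hX : a * x / 2 = 1 / 2 * a * x := by ring
  have hY : b * x / 2 = 1 / 2 * b * x := by ring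
  have hcX : Complex.I * (1 / 2 * b * x) = c * (Complex.I * (1 / 2 * a * x)) := by
    rw [hc]
    field_simp
  -- The two series agree term by term.
  have hJJ : Complex.Gamma (μ + 1) * Complex.Gamma (ν + 1) *
      (besselE μ (Complex.I * (1 / 2 * a * x)) * besselE ν (c * (Complex.I * (1 / 2 * a * x)))) *
        Complex.Gamma (μ + ν + 1) =
      4 * (1 - c ^ 2) ^ (μ + ν + 1) * ∫ t in Set.Ioi (0 : ℝ), F t * besselE ν (c * t) * w t := by
    refine ((hasSum_besselE_mul_besselE hμ1 hν1 _ c).mul_right _).unique ?_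
    convert! hsum.mul_left (4 * (1 - c ^ 2) ^ (μ + ν + 1)) using 2 with n
    have hTn : ∀ t : ℝ, T n t * besselE ν (c * t) * w t = (-z ^ 2) ^ n / ((Nat.factorial n : ℂ) *
        rising (μ + 1) n * rising (ν + 1) n * rising (μ + ν + 1) n) *
        ((t : ℂ) ^ (2 * n) * besselE ν (c * t) *
          ((t : ℂ) ^ (μ + 2 * ν + 1) * besselK μ (2 * (t : ℂ)))) := by
      intro t
      simp only [hT, hw, mul_pow, ← pow_mul]
      ring
    simp_rw [hTn]
    rw [integral_const_mul, setIntegral_pow_mul_besselE_mul_besselK hν hμν hab, ← terminating_pfaff]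
    simp only [Finset.mul_sum, Finset.sum_mul]
    refine Finset.sum_congr rfl fun j hj => ?_
    obtain ⟨m, rfl⟩ := Nat.exists_eq_add_of_le (Nat.lt_succ_iff.mp (Finset.mem_range.mp hj))
    have hG : Complex.Gamma (μ + ν + 1 + (j + m : ℕ) + j) = Complex.Gamma (μ + ν + 1) *
        (rising (μ + ν + 1) (j + m) * rising (μ + ν + 1 + (j + m : ℕ)) j) := by
      rw [add_assoc _ _ (j : ℂ), ← Nat.cast_add, Gamma_add_nat_eq_rising hA1, rising_add]
    have hpow : (1 - c ^ 2) ^ (μ + ν + 1 + (j + m : ℕ) + j) =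
        (1 - c ^ 2) ^ (μ + ν + 1) * (1 - c ^ 2) ^ (j + m) * (1 - c ^ 2) ^ j := by
      rw [Complex.cpow_add _ _ hq0, Complex.cpow_add _ _ hq0, Complex.cpow_natCast,
        Complex.cpow_natCast]
    have n1 : (1 - c ^ 2) ^ (μ + ν + 1) ≠ 0 := by simp [Complex.cpow_eq_zero_iff, hq0]
    have n2 := rising_ne_zero hA1 (j + m)
    have n3 := rising_ne_zero hμ1 (j + m)
    have n4 := rising_ne_zero hν1 (j + m)
    have hI : (Complex.I * (1 / 2 * a * x)) ^ (2 * (j + m)) = (-(1 / 2 * a * x) ^ 2) ^ (j + m) := by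
      rw [pow_mul, mul_pow, Complex.I_sq, neg_one_mul]
    have hzp : (-z ^ 2) ^ (j + m) =
        (-(1 / 2 * a * x) ^ 2) ^ (j + m) * ((1 - c ^ 2) ^ (j + m) * (1 - c ^ 2) ^ (j + m)) := by
      rw [hz, ← mul_pow, ← mul_pow]
      ring
    rw [hG, hpow, hI, hzp, Nat.add_sub_cancel_left]
    generalize (-(1 / 2 * a * x) ^ 2) ^ (j + m) = Y
    generalize Complex.Gamma (μ + ν + 1) = G
    generalize (1 - c ^ 2) ^ (μ + ν + 1) = Q at n1 ⊢
    generalize rising (μ + ν + 1) (j + m) = R₁ at n2 ⊢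
    generalize rising (μ + 1) (j + m) = R₂ at n3 ⊢
    generalize rising (ν + 1) (j + m) = R₃ at n4 ⊢
    generalize rising (μ + ν + 1 + (j + m : ℕ)) j = R₄
    generalize rising (ν + 1 + j) m = R₅
    generalize 1 - c ^ 2 = q at hq0 ⊢
    field_simp
    ring
  have hcν : c ^ (-ν) * c ^ ν = 1 := by
    rw [← Complex.cpow_add _ _ hc0, neg_add_cancel, Complex.cpow_zero]
  rw [besselJ_eq_besselE, besselJ_eq_besselE, hX, hY, hcX]
  linear_combination (1 / 2 * a * x) ^ μ * (1 / 2 * b * x) ^ ν * hJJ -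
    4 * (1 / 2 * a * x) ^ μ * (1 / 2 * b * x) ^ ν * (1 - c ^ 2) ^ (μ + ν + 1) *
      (∫ t in Set.Ioi (0 : ℝ), F t * besselE ν (c * t) * w t) * hcν
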